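/- **Definitions.** A Dyck path is a lattice path of $n\ge 0$ upsteps $U$ and $n$ downsteps $D$ that never goes below its starting level; $n$ is its size and $\epsilon$ is the empty path. A nonempty Dyck path is primitive if it returns to ground level only at its end; every Dyck path is uniquely a concatenation of primitive paths, its components. A subpath is a run of consecutive steps. Define the size-preserving map $F$ on Dyck paths recursively by $F(\epsilon)=\epsilon$; $F(P_1\cdots P_r)=F(P_1)\cdots F(P_r)$ if $P_1,\dots,P_r$ are the components of the path and $r\ge 2$; and, writing a primitive path uniquely as $P=U\,Q\,(UD)^iD$ with $i\ge 0$ and $Q$ a Dyck path that is empty or ends in $DD$, $$F(P)=\begin{cases}U^{i+1}F(R)\,UD\,D^{i+1} & \text{if } Q=URD \text{ is primitive},\\ U^{i+1}F(Q)D^{i+1} & \text{if } Q \text{ is not primitive.}\end{cases}$$ A composition $(c_1,\dots,c_h)$ of $n$ is identified with the $DUU$-avoiding Dyck path of size $n$ and height $h$ that has exactly $c_j$ downsteps ending at height $h-j$ $(1\le j\le h)$. An LCO forest is a finite list of ordered trees in which each vertex is labeled with a composition whose last entry is $1$; no vertex has exactly one child; exactly those vertices that have children and a label of size (sum of entries)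 $\ge 2$ carry a color, *top* or *bot*; and, whenever the rightmost child of a vertex is a leaf, its label has size $\ge 2$. An LCO forest determines a Dyck path recursively: the path of a forest is the concatenation of the paths of its trees, and the path of a tree is obtained from the path of its root label by inserting the path of the forest of subtrees of the root's children at the top or the bottom of the first peak upstep (an upstep followed by $D$), according to the color of the root (at the top if the root has no color). **Theorem.** 1. Every $F$-orbit on Dyck paths is finite and its size is a power of $2$. 2. Every Dyck path $P$ is the path of exactly one LCO forest, "the LCO forest of $P$". Let $\ell$ be the largest size of the label of a leaf (a vertex without children, isolated roots included) and $i$ the largest size of the label of an internal vertex (a vertex with children) of this forest, where the maximum over an empty set is $0$. Then the $F$-orbit of $P$ has size $2^k$, where $k$ is the number of binary digits of $\max\{\ell-2,\,i-1,\,0\}$ (the number $0$ has no digits). 3. A Dyck path $P$ satisfies $F(P)=P$ if and only if it contains neither the subpath $DUDD$ nor a subpath of the form $UUP^+DD$ with $P^+$ a nonempty Dyck path. 4. For $k\ge 0$ let $F_k(x)$ be the generating function, by size, of the Dyck paths whose $F$-orbit has size at most $2^k$, and put $a_k=(2x)^{2^k+1}$. Then, as formal power series, $$F_k(x)=\frac{1-a_k-\sqrt{1-4x+\dfrac{a_k(2-a_k)x}{1-x}}}{2x-a_k},$$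 where the square root is the one with constant term $1$. -/

import Mathlib

open DyckStep

namespace DyckOrbit

/-- The path `UD`. -/
def peak : DyckWord := DyckWord.nest 0

/-- A primitive Dyck path: nonempty, with exactly one return to ground level, i.e. nothing follows
its first component. -/
def IsPrimitive (P : DyckWord) : Prop := P ≠ 0 ∧ P.outsidePart = 0

instance (P : DyckWord) : Decidable (IsPrimitive P) := inferInstanceAs (Decidable (_ ∧ _))

/-- The factorization `P = Q (UD)^i` with `i` as large as possible, returned as `(Q, i)`; thus `Q`
is empty or ends with `DD`, see `splitPeaks_eq` and `splitPeaks_not_suffix`. Here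
`P = U P.insidePart D P.outsidePart` splits off the first component of `P`. -/
def splitPeaks (P : DyckWord) : DyckWord × ℕ :=
  if h : P = 0 then (0, 0)
  else
    let s := splitPeaks P.outsidePart
    if P.insidePart = 0 ∧ s.1 = 0 then (0, s.2 + 1) else (P.insidePart.nest + s.1, s.2)
termination_by P.semilength
decreasing_by exact DyckWord.semilength_outsidePart_lt h

theorem splitPeaks_eq (P : DyckWord) : (splitPeaks P).1 + (splitPeaks P).2 • peak = P := by
  induction hn : P.semilength using Nat.strong_induction_on generalizing P with
  | _ n ih =>
    rw [splitPeaks]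
    by_cases h : P = 0
    · simp [h]
    · have h1 := ih _ (hn ▸ DyckWord.semilength_outsidePart_lt h) P.outsidePart rfl
      simp only [h, dite_false]
      split_ifs with h2
      · rw [h2.2, zero_add] at h1
        conv_rhs => rw [← P.nest_insidePart_add_outsidePart h, h2.1, ← h1]
        rw [zero_add, succ_nsmul', peak]
      · simp only [add_assoc, h1, P.nest_insidePart_add_outsidePart h]

theorem splitPeaks_not_suffix (P : DyckWord) : ¬ [U, D] <:+ (splitPeaks P).1.toList := by
  induction hn : P.semilength using Nat.strong_induction_on generalizing P with
  | _ n ih =>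
    rw [splitPeaks]
    by_cases h : P = 0
    · simp only [h, dite_true]
      exact fun hh => by simpa [show (0 : DyckWord).toList = [] from rfl] using hh.length_le
    · have h1 := ih _ (hn ▸ DyckWord.semilength_outsidePart_lt h) P.outsidePart rfl
      simp only [h, dite_false]
      split_ifs with h2
      · exact fun hh => by simpa [show (0 : DyckWord).toList = [] from rfl] using hh.length_le
      · intro hh
        change [U, D] <:+ P.insidePart.nest.toList ++ (splitPeaks P.outsidePart).1.toList at hh
        by_cases h3 : (splitPeaks P.outsidePart).1 = 0
        · have h4 : P.insidePart ≠ 0 := fun h4 => h2 ⟨h4, h3⟩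
          have h5 := P.insidePart.getLast_eq_D (DyckWord.toList_ne_nil.mpr h4)
          have h6 : [U] <:+ U :: P.insidePart.toList := by
            have : [U] ++ [D] <:+ (U :: P.insidePart.toList) ++ [D] := by
              rw [h3] at hh
              simpa [DyckWord.nest, show (0 : DyckWord).toList = [] from rfl] using hh
            exact (List.suffix_append_inj_of_length_eq rfl).mp this |>.1
          obtain ⟨t, ht⟩ := h6
          have h7 : (U :: P.insidePart.toList).getLast (by simp) = D := by
            rw [List.getLast_cons (DyckWord.toList_ne_nil.mpr h4), h5]
          simp [← ht] at h7
        · refine h1 (List.suffix_of_suffix_length_le hh (List.suffix_append _ _) ?_)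
          have := (splitPeaks P.outsidePart).1.two_mul_semilength_eq_length
          have h4 : (splitPeaks P.outsidePart).1.toList.length ≠ 0 := by
            simpa [DyckWord.toList_eq_nil] using h3
          simp only [List.length_cons, List.length_nil]
          omega

theorem semilength_splitPeaks_le (P : DyckWord) : (splitPeaks P).1.semilength ≤ P.semilength := by
  conv_rhs => rw [← splitPeaks_eq P, DyckWord.semilength_add]
  exact Nat.le_add_right _ _

/-- The map `F`. It satisfies `F(ε) = ε` and acts on the components of a path separately. A primitive
path is uniquely `U Q (UD)^i D` with `Q` empty or ending in `DD`, and its image is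
`U^(i+1) F(R) U D D^(i+1)` if `Q = U R D` is primitive, and `U^(i+1) F(Q) D^(i+1)` otherwise. -/
def dyckF (P : DyckWord) : DyckWord :=
  if h : P = 0 then 0
  else
    let Q := (splitPeaks P.insidePart).1
    let i := (splitPeaks P.insidePart).2
    (if IsPrimitive Q then DyckWord.nest^[i + 1] (dyckF Q.insidePart + peak)
      else DyckWord.nest^[i + 1] (dyckF Q)) + dyckF P.outsidePart
termination_by P.semilength
decreasing_by
  · rename_i hQ
    exact (DyckWord.semilength_insidePart_lt hQ.1).trans
      ((semilength_splitPeaks_le _).trans_lt (DyckWord.semilength_insidePart_lt h))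
  · exact (semilength_splitPeaks_le _).trans_lt (DyckWord.semilength_insidePart_lt h)
  · exact DyckWord.semilength_outsidePart_lt h

/-- The size of the `F`-orbit (the cycle of `F`) through `P`: the least `m > 0` with `F^m(P) = P`
(and `0` if there were no such `m`). -/
noncomputable def orbitSize (P : DyckWord) : ℕ := Function.minimalPeriod dyckF P

/-- The `DUU`-avoiding path of a composition `(c_1, …, c_h)`: the path of height `h` with `c_j`
downsteps ending at height `h - j`. It is built from the top level down: a level with entry `m`
turns the part `w` above it into `U w D (UD)^(m-1)`. -/
def compSteps (c : List ℕ) : List DyckStep :=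
  c.foldl (fun w m => (U :: w) ++ D :: (List.replicate (m - 1) [U, D]).flatten) []

/-- The two possible colors of a vertex. -/
inductive Color
  | top
  | bot
  deriving DecidableEq

/-- Length of the initial run of upsteps; the last step of this run is the first peak upstep. -/
def initialRun (S : List DyckStep) : ℕ := (S.takeWhile (· = U)).length

/-- Insert `R` at the top (end) or at the bottom (start) of the first peak upstep of `S`. -/
def insertBody (S : List DyckStep) : Color → List DyckStep → List DyckStep
  | .top, R => S.take (initialRun S) ++ R ++ S.drop (initialRun S)
  | .bot, R => S.take (initialRun S - 1) ++ R ++ S.drop (initialRun S - 1)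

/-- Ordered forests whose vertices carry a list of natural numbers (the label) and possibly a color.
A forest is a list of ordered trees: either empty, or given by the label and the color of the root
of the first tree, the forest of the subtrees of its children, and the forest of the remaining
trees. -/
inductive Forest
  | nil
  | cons (label : List ℕ) (color : Option Color) (children rest : Forest)
  deriving DecidableEq

namespace Forest

/-- The number of trees of a forest. The outdegree of a vertex is the number of trees in the forest
of its children. -/
def numTrees : Forest → ℕ
  | nil => 0
  | cons _ _ _ rest => rest.numTrees + 1

/-- If the last tree of the forest is a single vertex, then its label has size at least `2`. -/
def LastLeafLarge : Forest → Prop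
  | nil => True
  | cons c _ children nil => children = nil → 2 ≤ c.sum
  | cons _ _ _ rest => rest.LastLeafLarge

/-- A label is a composition (a list of positive integers) with last entry `1`. -/
def IsLabel (c : List ℕ) : Prop := (∀ m ∈ c, 0 < m) ∧ c.getLast? = some 1

/-- LCO forests: each label is a composition ending in `1`; no vertex has exactly one child; exactly
the vertices that have children and a label of size at least `2` are colored; the rightmost child of
a vertex, if it is a leaf, has a label of size at least `2`. -/
def IsLCO : Forest → Prop
  | nil => True
  | cons c color children rest =>
    IsLabel c ∧ children.numTrees ≠ 1 ∧
      (color.isSome ↔ children ≠ nil ∧ 2 ≤ c.sum) ∧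
      children.LastLeafLarge ∧ children.IsLCO ∧ rest.IsLCO

/-- The steps of the Dyck path of a forest: the trees give the components, the label of a root gives
the skeleton of the component, and the forest of its children gives the body, which is inserted in
the skeleton at the position prescribed by the color (at the top if there is no color). -/
def steps : Forest → List DyckStep
  | nil => []
  | cons c color children rest =>
    insertBody (compSteps c) (color.getD .top) children.steps ++ rest.steps

/-- `T` is the LCO forest of the Dyck path `P`. -/
def IsLCOForestOf (T : Forest) (P : DyckWord) : Prop := T.IsLCO ∧ T.steps = P.toList

/-- The largest size of the label of a vertex without children (`0` if there is none). -/
def maxLeaf : Forest → ℕ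
  | nil => 0
  | cons c _ children rest =>
    max (if children = nil then c.sum else children.maxLeaf) rest.maxLeaf

/-- The largest size of the label of a vertex with children (`0` if there is none). -/
def maxInternal : Forest → ℕ
  | nil => 0
  | cons c _ children rest =>
    max (if children = nil then 0 else max c.sum children.maxInternal) rest.maxInternal

end Forest

/-- `P` does not contain `w` as a subpath, i.e. as a run of consecutive steps. -/
def Avoids (P : DyckWord) (w : List DyckStep) : Prop := ¬ w <:+: P.toList

/-- The generating function `F_k(x)` of the Dyck paths with `F`-orbit of size at most `2 ^ k`, by
size. -/
noncomputable def orbitGF (k : ℕ) : PowerSeries ℚ :=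
  PowerSeries.mk fun n => (({P : DyckWord | P.semilength = n ∧ orbitSize P ≤ 2 ^ k}.ncard : ℕ) : ℚ)

/-- The power series `a_k(x) = (2x)^(2^k+1)`. -/
noncomputable def aSeries (k : ℕ) : PowerSeries ℚ := (2 * PowerSeries.X) ^ (2 ^ k + 1)

end DyckOrbit

namespace DyckOrbit

theorem toList_zero : (0 : DyckWord).toList = [] := rfl

theorem toList_add (P Q : DyckWord) : (P + Q).toList = P.toList ++ Q.toList := rfl

theorem toList_nest (P : DyckWord) : P.nest.toList = U :: P.toList ++ [D] := rfl

theorem toList_peak : peak.toList = [U, D] := rfl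

theorem peak_ne_zero : peak ≠ 0 := DyckWord.nest_ne_zero

theorem semilength_peak : peak.semilength = 1 := rfl

theorem semilength_eq_zero {P : DyckWord} : P.semilength = 0 ↔ P = 0 := by
  rw [← DyckWord.toList_eq_nil, ← List.length_eq_zero_iff, ← P.two_mul_semilength_eq_length]
  omega

theorem nest_injective : Function.Injective DyckWord.nest := fun P Q h => by
  simpa using congrArg DyckWord.insidePart h

theorem nest_add_inj {P Q R S : DyckWord} : P.nest + R = Q.nest + S ↔ P = Q ∧ R = S := by
  refine ⟨fun h => ?_, by rintro ⟨rfl, rfl⟩; rfl⟩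
  obtain rfl : P = Q := by simpa using congrArg DyckWord.insidePart h
  exact ⟨rfl, add_left_cancel h⟩

theorem add_inj_of_semilength {P Q P' Q' : DyckWord} (h : P.semilength = P'.semilength) :
    P + Q = P' + Q' ↔ P = P' ∧ Q = Q' := by
  refine ⟨fun e => ?_, by rintro ⟨rfl, rfl⟩; rfl⟩
  have e' := congrArg DyckWord.toList e
  rw [toList_add, toList_add] at e'
  have hl : P.toList.length = P'.toList.length := by
    rw [← P.two_mul_semilength_eq_length, h, P'.two_mul_semilength_eq_length]
  obtain ⟨h1, h2⟩ := List.append_inj e' hl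
  exact ⟨DyckWord.ext h1, DyckWord.ext h2⟩

theorem exists_nest_add {P : DyckWord} (h : P ≠ 0) : ∃ Q R : DyckWord, P = Q.nest + R :=
  ⟨_, _, (DyckWord.nest_insidePart_add_outsidePart h).symm⟩

/-- Induction on the first component. -/
theorem nest_add_induction {p : DyckWord → Prop} (zero : p 0)
    (nest_add : ∀ Q R, p Q → p R → p (Q.nest + R)) (P : DyckWord) : p P := by
  induction hn : P.semilength using Nat.strong_induction_on generalizing P with
  | _ n ih =>
    by_cases h : P = 0
    · exact h ▸ zero
    · obtain ⟨Q, R, rfl⟩ := exists_nest_add h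
      simp only [DyckWord.semilength_add, DyckWord.semilength_nest] at hn
      exact nest_add Q R (ih _ (by omega) Q rfl) (ih _ (by omega) R rfl)

theorem exists_add_nest {P : DyckWord} (h : P ≠ 0) : ∃ Y Z, P = Y + DyckWord.nest Z := by
  induction P using nest_add_induction with
  | zero => exact absurd rfl h
  | nest_add Q R _ ih =>
    by_cases hR : R = 0
    · exact ⟨0, Q, by rw [hR, add_zero, zero_add]⟩
    · obtain ⟨Y, Z, hYZ⟩ := ih hR
      exact ⟨Q.nest + Y, Z, by rw [add_assoc, ← hYZ]⟩

theorem nest_eq_add {X Y Z : DyckWord} (h : X.nest = Y + Z) : Y = 0 ∨ Z = 0 := by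
  by_cases hY : Y = 0
  · exact .inl hY
  · right
    have := congrArg DyckWord.outsidePart h
    rw [DyckWord.outsidePart_add hY, DyckWord.outsidePart_nest] at this
    exact (add_eq_zero'.mp this.symm).2

theorem zero_of_nest_suffix {Y Z : DyckWord} (h : [U, D] <:+ (Y + Z.nest).toList) : Z = 0 := by
  by_contra hZ
  have h1 := Z.getLast_eq_D (DyckWord.toList_ne_nil.mpr hZ)
  rw [toList_add, toList_nest, ← List.dropLast_append_getLast (DyckWord.toList_ne_nil.mpr hZ), h1]
    at h
  have h2 : [U, D] <:+ (Y.toList ++ U :: Z.toList.dropLast) ++ [D, D] := by simpa using h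
  have := List.suffix_of_suffix_length_le h2 (List.suffix_append _ _) (by simp)
  simpa using this.eq_of_length

theorem suffix_peak_iff {P : DyckWord} : [U, D] <:+ P.toList ↔ ∃ Y, P = Y + peak := by
  constructor
  · intro h
    by_cases hP : P = 0
    · subst hP; simp [toList_zero] at h
    · obtain ⟨Y, Z, rfl⟩ := exists_add_nest hP
      exact ⟨Y, by rw [zero_of_nest_suffix h, peak]⟩
  · rintro ⟨Y, rfl⟩
    exact List.suffix_append _ _

theorem add_nest_ne_add_peak {Y Z Y' : DyckWord} (h : Y + Z.nest = Y' + peak) : Z = 0 :=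
  zero_of_nest_suffix (h ▸ suffix_peak_iff.mpr ⟨Y', rfl⟩)

theorem nsmul_peak_succ (i : ℕ) : (i + 1) • peak = i • peak + peak := succ_nsmul _ _

theorem semilength_nsmul_peak (i : ℕ) : (i • peak).semilength = i := by
  induction i with
  | zero => simp
  | succ i ih => rw [nsmul_peak_succ, DyckWord.semilength_add, ih, semilength_peak]

theorem add_nsmul_peak_inj {Q Q' : DyckWord} {i j : ℕ} (hQ : ∀ Y, Q ≠ Y + peak)
    (hQ' : ∀ Y, Q' ≠ Y + peak) (h : Q + i • peak = Q' + j • peak) : Q = Q' ∧ i = j := by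
  induction i generalizing j with
  | zero =>
    cases j with
    | zero => simpa using h
    | succ j => exact absurd (by simpa [nsmul_peak_succ, add_assoc] using h)
                  (hQ (Q' + j • peak))
  | succ i ih =>
    cases j with
    | zero => exact absurd (by simpa [nsmul_peak_succ, add_assoc] using h.symm)
                  (hQ' (Q + i • peak))
    | succ j =>
      rw [nsmul_peak_succ, nsmul_peak_succ, ← add_assoc, ← add_assoc] at h
      obtain ⟨h1, h2⟩ := ih (add_right_cancel h)
      exact ⟨h1, by rw [h2]⟩

theorem splitPeaks_add {Q : DyckWord} (hQ : ∀ Y, Q ≠ Y + peak) (i : ℕ) :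
    splitPeaks (Q + i • peak) = (Q, i) := by
  obtain ⟨h1, h2⟩ := add_nsmul_peak_inj
    (fun Y hY => splitPeaks_not_suffix _ (suffix_peak_iff.mpr ⟨Y, hY⟩)) hQ
    (splitPeaks_eq (Q + i • peak))
  exact Prod.ext h1 h2

/-- A nonempty path is a base if it is neither a shorter nonempty path followed by `UD` nor a
nonempty path raised by one level. -/
def IsBase (B : DyckWord) : Prop :=
  B ≠ 0 ∧ (∀ Y, B = Y + peak → Y = 0) ∧ ∀ X : DyckWord, B = X.nest → X = 0

/-- The path obtained from `B` by repeatedly appending a number of peaks and raising the result,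
the last step being the head of the list. -/
def build (B : DyckWord) : List ℕ → DyckWord
  | [] => B
  | i :: l => (build B l + i • peak).nest

/-- The total number of levels and peaks added by `build`. -/
def weight : List ℕ → ℕ
  | [] => 0
  | i :: l => weight l + (i + 1)

theorem isBase_peak : IsBase peak := by
  refine ⟨peak_ne_zero, fun Y h => ?_, fun X h => ?_⟩
  · rw [add_eq_right.mp h.symm]
  · exact nest_injective h.symm

theorem build_ne_zero {B : DyckWord} (hB : B ≠ 0) (l : List ℕ) : build B l ≠ 0 := by
  cases l with
  | nil => exact hB
  | cons i l => exact DyckWord.nest_ne_zero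

theorem semilength_build (B : DyckWord) (l : List ℕ) :
    (build B l).semilength = B.semilength + weight l := by
  induction l with
  | nil => rfl
  | cons i l ih =>
    rw [build, DyckWord.semilength_nest, DyckWord.semilength_add, ih, semilength_nsmul_peak, weight]
    omega

theorem build_eq_add_peak {B Y : DyckWord} (hB : IsBase B) {l : List ℕ}
    (h : build B l = Y + peak) : Y = 0 := by
  cases l with
  | nil => exact hB.2.1 Y h
  | cons i l => exact (nest_eq_add h).resolve_right peak_ne_zero

theorem build_eq_peak {B : DyckWord} (hB : IsBase B) {l : List ℕ} (h : build B l = peak) :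
    B = peak ∧ l = [] := by
  cases l with
  | nil => exact ⟨h, rfl⟩
  | cons i l =>
    exact absurd (add_eq_zero'.mp (nest_injective h)).1 (build_ne_zero hB.1 l)

theorem build_add_nsmul_inj {X Y : DyckWord} (hX0 : X ≠ 0) (hY0 : Y ≠ 0)
    (hX : ∀ Z, X = Z + peak → Z = 0) (hY : ∀ Z, Y = Z + peak → Z = 0) {i j : ℕ}
    (h : X + i • peak = Y + j • peak) : X = Y ∧ i = j := by
  induction i generalizing j with
  | zero =>
    cases j with
    | zero => simpa using h
    | succ j =>
      refine absurd (add_eq_zero'.mp (hX (Y + j • peak) ?_)).1 hY0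
      simpa [nsmul_peak_succ, add_assoc] using h
  | succ i ih =>
    cases j with
    | zero =>
      refine absurd (add_eq_zero'.mp (hY (X + i • peak) ?_)).1 hX0
      simpa [nsmul_peak_succ, add_assoc] using h.symm
    | succ j =>
      rw [nsmul_peak_succ, nsmul_peak_succ, ← add_assoc, ← add_assoc] at h
      obtain ⟨h1, h2⟩ := ih (add_right_cancel h)
      exact ⟨h1, by rw [h2]⟩

theorem build_inj {B B' : DyckWord} (hB : IsBase B) (hB' : IsBase B') {l l' : List ℕ}
    (h : build B l = build B' l') : B = B' ∧ l = l' := by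
  induction l generalizing l' with
  | nil =>
    cases l' with
    | nil => exact ⟨h, rfl⟩
    | cons j l' =>
      exact absurd (add_eq_zero'.mp (hB.2.2 _ h)).1 (build_ne_zero hB'.1 l')
  | cons i l ih =>
    cases l' with
    | nil => exact absurd (add_eq_zero'.mp (hB'.2.2 _ h.symm)).1 (build_ne_zero hB.1 l)
    | cons j l' =>
      obtain ⟨h1, h2⟩ := build_add_nsmul_inj (build_ne_zero hB.1 l) (build_ne_zero hB'.1 l')
        (fun Z => build_eq_add_peak hB) (fun Z => build_eq_add_peak hB') (nest_injective h)
      obtain ⟨h3, h4⟩ := ih h1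
      exact ⟨h3, by rw [h2, h4]⟩

theorem exists_build {P : DyckWord} (h0 : P ≠ 0) (hP : ∀ Y, P = Y + peak → Y = 0) :
    ∃ B l, IsBase B ∧ P = build B l := by
  induction hn : P.semilength using Nat.strong_induction_on generalizing P with
  | _ n ih =>
    by_cases hX : ∀ X : DyckWord, P = X.nest → X = 0
    · exact ⟨P, [], ⟨h0, hP, hX⟩, rfl⟩
    · push Not at hX
      obtain ⟨X, rfl, hX⟩ := hX
      have hs := splitPeaks_eq X
      have hn' := congrArg DyckWord.semilength hs
      rw [DyckWord.semilength_add, semilength_nsmul_peak] at hn'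
      rw [DyckWord.semilength_nest] at hn
      by_cases hQ : (splitPeaks X).1 = 0
      · rw [hQ, zero_add] at hs
        obtain ⟨i, hi⟩ : ∃ i, (splitPeaks X).2 = i + 1 :=
          Nat.exists_eq_succ_of_ne_zero fun h => hX (by rw [← hs, h, zero_nsmul])
        refine ⟨peak, [i], isBase_peak, ?_⟩
        rw [build, build, ← hs, hi, succ_nsmul']
      · obtain ⟨B, l, hB, h⟩ := ih _ (by omega) hQ
          (fun Y hY => absurd (suffix_peak_iff.mpr ⟨Y, hY⟩) (splitPeaks_not_suffix X)) rfl
        exact ⟨B, (splitPeaks X).2 :: l, hB, by rw [build, ← h, hs]⟩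

theorem exists_build_nest (Q : DyckWord) : ∃ B l, IsBase B ∧ Q.nest = build B l :=
  exists_build DyckWord.nest_ne_zero fun _ h => (nest_eq_add h).resolve_right peak_ne_zero

theorem build_eq_nest {B : DyckWord} {l : List ℕ} (h : B = peak ∨ l ≠ []) :
    ∃ Q, build B l = DyckWord.nest Q := by
  cases l with
  | nil => exact ⟨0, h.resolve_right (by simp)⟩
  | cons i l => exact ⟨_, rfl⟩

theorem IsBase.peak_or_ne_nil {B Q : DyckWord} {l : List ℕ} (hB : IsBase B)
    (h : build B l = DyckWord.nest Q) : B = peak ∨ l ≠ [] := by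
  cases l with
  | nil => exact .inl (by rw [show B = Q.nest from h, hB.2.2 Q h, peak])
  | cons i l => exact .inr (by simp)

/-! ### The action of `F` -/

theorem dyckF_zero : dyckF 0 = 0 := by rw [dyckF]; simp

theorem dyckF_nest_add (Q R : DyckWord) : dyckF (Q.nest + R) = dyckF Q.nest + dyckF R := by
  conv_lhs => rw [dyckF]
  conv_rhs => rw [dyckF]
  simp [dyckF_zero]

theorem dyckF_add (P Q : DyckWord) : dyckF (P + Q) = dyckF P + dyckF Q := by
  induction P using nest_add_induction with
  | zero => rw [dyckF_zero, zero_add, zero_add]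
  | nest_add X Y _ ih => rw [add_assoc, dyckF_nest_add, ih, dyckF_nest_add, add_assoc]

theorem dyckF_nest_of_not_nest {Q : DyckWord} (hQ : ∀ Y, Q ≠ Y + peak)
    (hQ' : ∀ X : DyckWord, Q ≠ X.nest) (i : ℕ) :
    dyckF (Q + i • peak).nest = DyckWord.nest^[i + 1] (dyckF Q) := by
  have : ¬ IsPrimitive Q := fun h => hQ' Q.insidePart (by
    conv_lhs => rw [← DyckWord.nest_insidePart_add_outsidePart h.1, h.2, add_zero])
  rw [dyckF]
  simp [splitPeaks_add hQ, this, dyckF_zero]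

theorem dyckF_nest_nest {R : DyckWord} (hR : R ≠ 0) (i : ℕ) :
    dyckF (R.nest + i • peak).nest = DyckWord.nest^[i + 1] (dyckF R + peak) := by
  have hQ : ∀ Y, R.nest ≠ Y + peak := fun Y h =>
    hR (add_nest_ne_add_peak (Y := 0) (by rw [zero_add, h]))
  have : IsPrimitive R.nest := ⟨DyckWord.nest_ne_zero, by simp⟩
  rw [dyckF]
  simp [splitPeaks_add hQ, this, dyckF_zero]

theorem dyckF_peak : dyckF peak = peak := by
  have := dyckF_nest_of_not_nest (Q := 0) (fun Y h => peak_ne_zero (add_eq_zero'.mp h.symm).2)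
    (fun X h => DyckWord.nest_ne_zero h.symm) 0
  simpa [dyckF_zero, peak] using this

theorem dyckF_nsmul_peak (i : ℕ) : dyckF (i • peak) = i • peak := by
  induction i with
  | zero => simp [dyckF_zero]
  | succ i ih => rw [nsmul_peak_succ, dyckF_add, ih, dyckF_peak]

/-- The map on lists of naturals corresponding to `F`. -/
def listF : List ℕ → List ℕ
  | [] => []
  | [i] => List.replicate (i + 1) 0
  | i :: j :: l => List.replicate i 0 ++ (j + 1) :: listF l

theorem build_append (B : DyckWord) (l l' : List ℕ) : build B (l ++ l') = build (build B l') l := by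
  induction l with
  | nil => rfl
  | cons i l ih => rw [List.cons_append, build, ih, build]

theorem build_replicate (B : DyckWord) (i : ℕ) :
    build B (List.replicate i 0) = DyckWord.nest^[i] B := by
  induction i with
  | zero => rfl
  | succ i ih =>
    rw [List.replicate_succ, build, ih, zero_nsmul, add_zero, Function.iterate_succ_apply']

theorem dyckF_build {B : DyckWord} (hB : IsBase B) (l : List ℕ) :
    dyckF (build B l) = build (dyckF B) (listF l) := by
  induction l using listF.induct with
  | case1 => rfl
  | case2 i =>
    rw [listF, build_replicate, build, build]
    by_cases h : B = peak
    · rw [h, dyckF_peak]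
      have := dyckF_nest_of_not_nest (Q := 0) (fun Y h => peak_ne_zero (add_eq_zero'.mp h.symm).2)
        (fun X h => DyckWord.nest_ne_zero h.symm) (i + 1)
      rw [zero_add, succ_nsmul', dyckF_zero, Function.iterate_succ_apply] at this
      exact this
    · refine dyckF_nest_of_not_nest (fun Y hY => h ?_) (fun X hX => h ?_) i
      · rw [hY, hB.2.1 Y hY, zero_add]
      · rw [hX, hB.2.2 X hX, peak]
  | case3 i j l ih =>
    rw [build, build, dyckF_nest_nest fun h => build_ne_zero hB.1 l (add_eq_zero'.mp h).1,
      dyckF_add, dyckF_nsmul_peak, ih, listF, build_append, build_replicate, build,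
      Function.iterate_succ_apply, add_assoc, ← nsmul_peak_succ]

theorem weight_append (l l' : List ℕ) : weight (l ++ l') = weight l + weight l' := by
  induction l with
  | nil => simp [weight]
  | cons i l ih => rw [List.cons_append, weight, ih, weight]; omega

theorem weight_replicate (i : ℕ) : weight (List.replicate i 0) = i := by
  induction i with
  | zero => rfl
  | succ i ih => rw [List.replicate_succ, weight, ih]

theorem weight_listF (l : List ℕ) : weight (listF l) = weight l := by
  induction l using listF.induct with
  | case1 => rfl
  | case2 i => rw [listF, weight_replicate, weight, weight]; omega
  | case3 i j l ih =>
    rw [listF, weight_append, weight_replicate, weight, ih, weight, weight]; omega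

theorem semilength_dyckF (P : DyckWord) : (dyckF P).semilength = P.semilength := by
  induction hn : P.semilength using Nat.strong_induction_on generalizing P with
  | _ n ih =>
    by_cases h : P = 0
    · rw [h, dyckF_zero, ← h, hn]
    · obtain ⟨Q, R, rfl⟩ := exists_nest_add h
      simp only [DyckWord.semilength_add, DyckWord.semilength_nest] at hn
      rw [dyckF_add, DyckWord.semilength_add, ih _ (by omega) R rfl]
      obtain ⟨B, l, hB, hl⟩ := exists_build_nest Q
      have h1 := congrArg DyckWord.semilength hl
      rw [DyckWord.semilength_nest, semilength_build] at h1
      have h2 : (dyckF B).semilength = B.semilength := by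
        by_cases hw : l = []
        · rcases hB.peak_or_ne_nil hl.symm with h3 | h3
          · rw [h3, dyckF_peak]
          · exact absurd hw h3
        · refine ih _ ?_ B rfl
          have : 0 < weight l := by
            cases l with
            | nil => exact absurd rfl hw
            | cons => rw [weight]; omega
          omega
      rw [hl, dyckF_build hB, semilength_build, weight_listF, h2]
      omega

theorem dyckF_eq_zero {P : DyckWord} : dyckF P = 0 ↔ P = 0 := by
  rw [← semilength_eq_zero, semilength_dyckF, semilength_eq_zero]

theorem exists_dyckF_nest (Z : DyckWord) :
    ∃ W : DyckWord, dyckF Z.nest = W.nest ∧ W.semilength = Z.semilength := by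
  obtain ⟨B, l, hB, hl⟩ := exists_build_nest Z
  have h1 : dyckF B = peak ∨ listF l ≠ [] := by
    rcases hB.peak_or_ne_nil hl.symm with h | h
    · exact .inl (by rw [h, dyckF_peak])
    · right
      match l, h with
      | [i], _ => simp [listF]
      | i :: j :: l, _ => simp [listF]
  obtain ⟨W, hW⟩ := build_eq_nest h1
  rw [← dyckF_build hB, ← hl] at hW
  refine ⟨W, hW, ?_⟩
  have := congrArg DyckWord.semilength hW
  rw [semilength_dyckF, DyckWord.semilength_nest, DyckWord.semilength_nest] at this
  omega

theorem IsBase.map {B : DyckWord} (hB : IsBase B) : IsBase (dyckF B) := by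
  obtain ⟨Y, Z, rfl⟩ := exists_add_nest hB.1
  by_cases hY : Y = 0
  · have hZ := hB.2.2 Z (by rw [hY, zero_add])
    rw [hY, hZ, zero_add]
    exact dyckF_peak ▸ isBase_peak
  · have hZ : Z ≠ 0 := fun h => hY (hB.2.1 Y (by rw [h, peak]))
    obtain ⟨W, hW, hWZ⟩ := exists_dyckF_nest Z
    have hW0 : W ≠ 0 := by rwa [ne_eq, ← semilength_eq_zero, hWZ, semilength_eq_zero]
    rw [dyckF_add, hW]
    refine ⟨fun h => DyckWord.nest_ne_zero (add_eq_zero'.mp h).2,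
      fun Y' h => absurd (add_nest_ne_add_peak h) hW0, fun X h => ?_⟩
    rcases nest_eq_add h.symm with h1 | h1
    · exact absurd (dyckF_eq_zero.mp h1) hY
    · exact absurd h1 DyckWord.nest_ne_zero

/-! ### Periods of the map on lists -/

open Polynomial in
/-- The binary word `1 0^i 1 0^j ...` of a list `i, j, ...`, as a polynomial. -/
noncomputable def listPoly : List ℕ → (ZMod 2)[X]
  | [] => 0
  | i :: l => 1 + X ^ (i + 1) * listPoly l

open Polynomial in
theorem one_add_X_mul_listPoly_replicate (i : ℕ) : (1 + X : (ZMod 2)[X]) * listPoly (List.replicate i 0) =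
    1 + X ^ i := by
  induction i with
  | zero => simp [listPoly, CharTwo.add_self_eq_zero]
  | succ i ih =>
    rw [List.replicate_succ, listPoly, mul_add, mul_left_comm, ih]
    have : (X : (ZMod 2)[X]) + X = 0 := CharTwo.add_self_eq_zero X
    linear_combination this

open Polynomial in
theorem listPoly_append (l l' : List ℕ) :
    listPoly (l ++ l') = listPoly l + X ^ weight l * listPoly l' := by
  induction l with
  | nil => simp [listPoly, weight]
  | cons i l ih => rw [List.cons_append, listPoly, ih, listPoly, weight]; ring

open Polynomial in
theorem listPoly_listF (l : List ℕ) :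
    X ^ weight l ∣ (1 + X) * listPoly (listF l) - listPoly l := by
  induction l using listF.induct with
  | case1 => simp [listF, listPoly]
  | case2 i => rw [listF, one_add_X_mul_listPoly_replicate, listPoly, listPoly, weight, weight]; simp
  | case3 i j l ih =>
    obtain ⟨q, hq⟩ := ih
    refine ⟨q, ?_⟩
    rw [listF, listPoly_append, weight_replicate, mul_add, one_add_X_mul_listPoly_replicate]
    simp only [listPoly, weight]
    have : (X : (ZMod 2)[X]) ^ i + X ^ i = 0 := CharTwo.add_self_eq_zero _
    linear_combination X ^ (i + j + 2) * hq + this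

theorem weight_listF_iterate (t : ℕ) (l : List ℕ) : weight (listF^[t] l) = weight l := by
  induction t with
  | zero => rfl
  | succ t ih => rw [Function.iterate_succ_apply', weight_listF, ih]

open Polynomial in
theorem listPoly_iterate (t : ℕ) (l : List ℕ) :
    X ^ weight l ∣ (1 + X) ^ t * listPoly (listF^[t] l) - listPoly l := by
  induction t with
  | zero => simp
  | succ t ih =>
    have := (listPoly_listF (listF^[t] l)).mul_left ((1 + X) ^ t)
    rw [weight_listF_iterate] at this
    convert dvd_add this ih using 1
    rw [Function.iterate_succ_apply']
    ring

open Polynomial in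
theorem coeff_zero_listPoly {l : List ℕ} (h : l ≠ []) : (listPoly l).coeff 0 = 1 := by
  cases l with
  | nil => exact absurd rfl h
  | cons i l => simp [listPoly, mul_coeff_zero]

theorem eq_nil_of_weight {l : List ℕ} (h : weight l = 0) : l = [] := by
  cases l with
  | nil => rfl
  | cons i l => simp [weight] at h

open Polynomial in
theorem le_of_listPoly_dvd {l l' : List ℕ} {i j : ℕ} (h : weight (i :: l) = weight (j :: l'))
    (hd : X ^ weight (i :: l) ∣ listPoly (i :: l) - listPoly (j :: l')) : j ≤ i := by
  by_contra! hij
  simp only [weight] at h hd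
  have hl : l ≠ [] := by
    rintro rfl
    simp only [weight] at h
    omega
  obtain ⟨d, rfl⟩ := Nat.exists_eq_add_of_lt hij
  have h1 : X ^ (i + 1) * X ∣ X ^ (i + 1) * (listPoly l - X ^ (d + 1) * listPoly l') := by
    refine (Dvd.dvd.trans ?_ hd).trans (dvd_of_eq ?_)
    · rw [← pow_succ]
      exact pow_dvd_pow _ (by omega)
    · simp only [listPoly]
      ring
  have h2 := (mul_dvd_mul_iff_left (pow_ne_zero _ X_ne_zero)).mp h1
  rw [X_dvd_iff, coeff_sub, coeff_zero_listPoly hl, mul_coeff_zero] at h2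
  simp at h2

open Polynomial in
theorem eq_of_listPoly_dvd {l l' : List ℕ} (h : weight l = weight l')
    (hd : X ^ weight l ∣ listPoly l - listPoly l') : l = l' := by
  induction l generalizing l' with
  | nil => exact (eq_nil_of_weight h.symm).symm
  | cons i l ih =>
    cases l' with
    | nil => exact eq_nil_of_weight h
    | cons j l' =>
      obtain rfl : i = j := le_antisymm
        (le_of_listPoly_dvd h.symm (h ▸ (dvd_sub_comm.mp hd))) (le_of_listPoly_dvd h hd)
      simp only [weight, listPoly] at h hd
      rw [ih (l' := l') (by omega)]
      rw [add_sub_add_left_eq_sub, ← mul_sub, add_comm, pow_add] at hd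
      exact (mul_dvd_mul_iff_left (pow_ne_zero _ X_ne_zero)).mp hd

open Polynomial in
theorem isPeriodicPt_listF {l : List ℕ} (hl : l ≠ []) (t : ℕ) :
    Function.IsPeriodicPt listF t l ↔ X ^ weight l ∣ ((1 + X) ^ t - 1 : (ZMod 2)[X]) := by
  have h1 := listPoly_iterate t l
  have hc : IsCoprime (X ^ weight l : (ZMod 2)[X]) (listPoly l) := by
    refine IsCoprime.pow_left ((irreducible_X.coprime_iff_not_dvd).mpr ?_)
    rw [X_dvd_iff, coeff_zero_listPoly hl]
    exact one_ne_zero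
  have hu : IsCoprime (X ^ weight l : (ZMod 2)[X]) ((1 + X) ^ t) :=
    IsCoprime.pow ⟨-1, 1, by ring⟩
  constructor
  · intro h
    rw [h.eq] at h1
    exact hc.dvd_of_dvd_mul_right (by convert h1 using 1; ring)
  · intro h
    refine (eq_of_listPoly_dvd (weight_listF_iterate t l) ?_)
    rw [weight_listF_iterate]
    refine hu.dvd_of_dvd_mul_left ?_
    convert dvd_sub h1 (h.mul_right (listPoly l)) using 1
    ring

open Polynomial in
theorem isPeriodicPt_listF_two_pow {l : List ℕ} (hl : l ≠ []) (k : ℕ) :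
    Function.IsPeriodicPt listF (2 ^ k) l ↔ weight l ≤ 2 ^ k := by
  rw [isPeriodicPt_listF hl, add_pow_char_pow, one_pow, add_sub_cancel_left]
  exact pow_dvd_pow_iff X_ne_zero not_isUnit_X

theorem minimalPeriod_listF (l : List ℕ) :
    Function.minimalPeriod listF l = 2 ^ Nat.size (weight l - 1) := by
  by_cases hl : l = []
  · subst hl
    exact Function.minimalPeriod_eq_one_iff_isFixedPt.mpr rfl
  · have hw : 0 < weight l := Nat.pos_of_ne_zero fun h => hl (eq_nil_of_weight h)
    cases hk : Nat.size (weight l - 1) with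
    | zero =>
      rw [pow_zero, Function.minimalPeriod_eq_one_iff_isFixedPt]
      have := (isPeriodicPt_listF_two_pow hl 0).mpr (by have := Nat.size_eq_zero.mp hk; omega)
      simpa [Function.IsPeriodicPt] using this
    | succ k =>
      refine Function.minimalPeriod_eq_prime_pow ?_ ?_ <;> rw [isPeriodicPt_listF_two_pow hl]
      · have := Nat.lt_size.mp (show k < (weight l - 1).size by omega)
        omega
      · have := Nat.size_le.mp hk.le
        omega

/-! ### Orbit sizes -/

theorem minimalPeriod_eq_lcm {α β γ : Type*} {f : α → α} {g : β → β} {h : γ → γ} {x : α} {y : β}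
    {z : γ} (H : ∀ n, Function.IsPeriodicPt f n x ↔
      Function.IsPeriodicPt g n y ∧ Function.IsPeriodicPt h n z) :
    Function.minimalPeriod f x =
      Nat.lcm (Function.minimalPeriod g y) (Function.minimalPeriod h z) := by
  simp only [Function.isPeriodicPt_iff_minimalPeriod_dvd] at H
  exact Nat.dvd_antisymm ((H _).mpr ⟨Nat.dvd_lcm_left _ _, Nat.dvd_lcm_right _ _⟩)
    (Nat.lcm_dvd ((H _).mp dvd_rfl).1 ((H _).mp dvd_rfl).2)

theorem semilength_dyckF_iterate (t : ℕ) (P : DyckWord) :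
    (dyckF^[t] P).semilength = P.semilength := by
  induction t with
  | zero => rfl
  | succ t ih => rw [Function.iterate_succ_apply', semilength_dyckF, ih]

theorem dyckF_iterate_add (t : ℕ) (P Q : DyckWord) :
    dyckF^[t] (P + Q) = dyckF^[t] P + dyckF^[t] Q := by
  induction t with
  | zero => rfl
  | succ t ih => simp only [Function.iterate_succ_apply', ih, dyckF_add]

theorem IsBase.iterate {B : DyckWord} (hB : IsBase B) (t : ℕ) : IsBase (dyckF^[t] B) := by
  induction t with
  | zero => exact hB
  | succ t ih => rw [Function.iterate_succ_apply']; exact ih.map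

theorem dyckF_iterate_build {B : DyckWord} (hB : IsBase B) (t : ℕ) (l : List ℕ) :
    dyckF^[t] (build B l) = build (dyckF^[t] B) (listF^[t] l) := by
  induction t with
  | zero => rfl
  | succ t ih => simp only [Function.iterate_succ_apply', ih, dyckF_build (hB.iterate t)]

theorem orbitSize_zero : orbitSize 0 = 1 :=
  Function.minimalPeriod_eq_one_iff_isFixedPt.mpr dyckF_zero

theorem orbitSize_peak : orbitSize peak = 1 :=
  Function.minimalPeriod_eq_one_iff_isFixedPt.mpr dyckF_peak

theorem orbitSize_add (P Q : DyckWord) :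
    orbitSize (P + Q) = Nat.lcm (orbitSize P) (orbitSize Q) :=
  minimalPeriod_eq_lcm fun n => by
    simp only [Function.IsPeriodicPt, Function.IsFixedPt]
    rw [dyckF_iterate_add, add_inj_of_semilength (semilength_dyckF_iterate n P)]

theorem orbitSize_build {B : DyckWord} (hB : IsBase B) (l : List ℕ) :
    orbitSize (build B l) = Nat.lcm (orbitSize B) (2 ^ Nat.size (weight l - 1)) := by
  rw [← minimalPeriod_listF]
  refine minimalPeriod_eq_lcm fun n => ?_
  simp only [Function.IsPeriodicPt, Function.IsFixedPt]
  rw [dyckF_iterate_build hB]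
  exact ⟨build_inj (hB.iterate n) hB, fun h => by rw [h.1, h.2]⟩

theorem lcm_two_pow_size (a b : ℕ) :
    Nat.lcm (2 ^ Nat.size a) (2 ^ Nat.size b) = 2 ^ Nat.size (max a b) := by
  rcases le_total a b with h | h
  · rw [max_eq_right h, Nat.lcm_eq_right (pow_dvd_pow 2 (Nat.size_le_size h))]
  · rw [max_eq_left h, Nat.lcm_eq_left (pow_dvd_pow 2 (Nat.size_le_size h))]

theorem exists_orbitSize (P : DyckWord) : ∃ a, orbitSize P = 2 ^ Nat.size a := by
  induction hn : P.semilength using Nat.strong_induction_on generalizing P with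
  | _ n ih =>
    by_cases h : P = 0
    · exact ⟨0, by rw [h, orbitSize_zero]; simp⟩
    · obtain ⟨Q, R, rfl⟩ := exists_nest_add h
      simp only [DyckWord.semilength_add, DyckWord.semilength_nest] at hn
      obtain ⟨a, ha⟩ := ih _ (by omega) R rfl
      obtain ⟨B, l, hB, hl⟩ := exists_build_nest Q
      have h1 := congrArg DyckWord.semilength hl
      rw [DyckWord.semilength_nest, semilength_build] at h1
      obtain ⟨b, hb⟩ : ∃ b, orbitSize B = 2 ^ Nat.size b := by
        by_cases hw : l = []
        · rcases hB.peak_or_ne_nil hl.symm with h3 | h3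
          · exact ⟨0, by rw [h3, orbitSize_peak]; simp⟩
          · exact absurd hw h3
        · refine ih _ ?_ B rfl
          have : 0 < weight l := Nat.pos_of_ne_zero fun h => hw (eq_nil_of_weight h)
          omega
      exact ⟨_, by rw [orbitSize_add, hl, orbitSize_build hB, hb, ha, lcm_two_pow_size,
        lcm_two_pow_size]⟩

/-! ### The path of a forest -/

/-- One level of `compSteps`. -/
def levelSteps (w : List DyckStep) (m : ℕ) : List DyckStep :=
  (U :: w) ++ D :: (List.replicate (m - 1) [U, D]).flatten

theorem compSteps_eq_foldl (c : List ℕ) : compSteps c = c.foldl levelSteps [] := rfl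

theorem toList_nsmul_peak (i : ℕ) : (i • peak).toList = (List.replicate i [U, D]).flatten := by
  induction i with
  | zero => simp [toList_zero]
  | succ i ih =>
    rw [succ_nsmul', toList_add, ih, toList_peak, List.replicate_succ, List.flatten_cons]

theorem levelSteps_toList (W : DyckWord) (j : ℕ) :
    levelSteps W.toList (j + 1) = (W.nest + j • peak).toList := by
  simp [levelSteps, toList_add, toList_nest, toList_nsmul_peak]

theorem foldl_levelSteps (W : DyckWord) (l : List ℕ) :
    (l.map (· + 1) ++ [1]).foldl levelSteps W.toList = (build W.nest l.reverse).toList := by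
  induction l generalizing W with
  | nil => simpa [build] using levelSteps_toList W 0
  | cons j l ih =>
    rw [List.map_cons, List.cons_append, List.foldl_cons, levelSteps_toList, ih,
      List.reverse_cons, build_append, build, build]

theorem initialRun_levelSteps (w : List DyckStep) (m : ℕ) :
    initialRun (levelSteps w m) = initialRun w + 1 := by
  have (v : List DyckStep) : (w ++ D :: v).takeWhile (· = U) = w.takeWhile (· = U) := by
    induction w with
    | nil => simp
    | cons s w ih => cases s <;> simp [ih]
  simp [initialRun, levelSteps, this]

theorem initialRun_le (w : List DyckStep) : initialRun w ≤ w.length :=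
  (List.takeWhile_sublist _).length_le

theorem insertBody_levelSteps {w : List DyckStep} {color : Color}
    (h : color = .bot → 0 < initialRun w) (m : ℕ) (R : List DyckStep) :
    insertBody (levelSteps w m) color R = levelSteps (insertBody w color R) m := by
  have h1 := initialRun_le w
  have h3 := initialRun_levelSteps w m
  cases color with
  | top =>
    rw [insertBody, h3]
    simp [insertBody, levelSteps, List.take_append_of_le_length h1,
      List.drop_append_of_le_length h1]
  | bot =>
    obtain ⟨r, hr⟩ := Nat.exists_eq_add_of_lt (h rfl)
    rw [zero_add] at hr
    have h2 : r ≤ w.length := by omega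
    rw [insertBody, h3, hr]
    simp [insertBody, levelSteps, hr, List.take_append_of_le_length h2,
      List.drop_append_of_le_length h2]

theorem insertBody_foldl {w : List DyckStep} {color : Color}
    (h : color = .bot → 0 < initialRun w) (c : List ℕ) (R : List DyckStep) :
    insertBody (c.foldl levelSteps w) color R = c.foldl levelSteps (insertBody w color R) := by
  induction c generalizing w with
  | nil => rfl
  | cons m c ih =>
    rw [List.foldl_cons, List.foldl_cons, ih fun _ => by rw [initialRun_levelSteps]; omega,
      insertBody_levelSteps h]

theorem insertBody_top (l : List ℕ) (R : DyckWord) :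
    insertBody (compSteps (l.map (· + 1) ++ [1])) .top R.toList =
      (build R (0 :: l).reverse).toList := by
  rw [compSteps_eq_foldl, insertBody_foldl (by simp), List.reverse_cons, build_append, build,
    build, zero_nsmul, add_zero, ← foldl_levelSteps]
  simp [insertBody]

theorem insertBody_bot (j : ℕ) (l : List ℕ) (R : DyckWord) :
    insertBody (compSteps ((j :: l).map (· + 1) ++ [1])) .bot R.toList =
      (build R ((j + 1) :: l).reverse).toList := by
  rw [compSteps_eq_foldl, List.map_cons, List.cons_append, List.foldl_cons,
    insertBody_foldl (by rw [initialRun_levelSteps]; omega), List.reverse_cons, build_append,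
    build, build, ← foldl_levelSteps, toList_add, succ_nsmul', toList_add]
  have := levelSteps_toList 0 j
  rw [toList_zero] at this
  rw [this]
  simp [insertBody, initialRun, toList_add, toList_nest, toList_peak, toList_zero]

theorem insertBody_nil (S : List DyckStep) (color : Color) : insertBody S color [] = S := by
  cases color <;> simp [insertBody]

theorem compSteps_label (l : List ℕ) :
    compSteps (l.map (· + 1) ++ [1]) = (build peak l.reverse).toList := by
  have := insertBody_top l 0
  rw [toList_zero, insertBody_nil, List.reverse_cons, build_append] at this
  simpa [build, peak] using this

/-- The list of naturals encoding the label and the color of a vertex. -/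
def vertexCode (c : List ℕ) (color : Option Color) (children : Forest) : List ℕ :=
  if children = .nil then (c.dropLast.map (· - 1)).reverse
  else if color = some .bot then ((c.dropLast.map (· - 1)).modifyHead (· + 1)).reverse
  else (0 :: c.dropLast.map (· - 1)).reverse

/-- The Dyck path of a forest. -/
def Forest.word : Forest → DyckWord
  | nil => 0
  | cons c color children rest =>
    build (if children = nil then peak else children.word) (vertexCode c color children) + rest.word

theorem isLabel_iff {c : List ℕ} : Forest.IsLabel c ↔ ∃ l : List ℕ, c = l.map (· + 1) ++ [1] := by
  constructor
  · rintro ⟨h1, h2⟩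
    obtain ⟨c, rfl⟩ := List.getLast?_eq_some_iff.mp h2
    refine ⟨c.map (· - 1), ?_⟩
    rw [List.map_map]
    congr 1
    refine (List.map_id c).symm.trans (List.map_congr_left fun m hm => ?_)
    have := h1 m (by simp [hm])
    simp only [id, Function.comp]
    omega
  · rintro ⟨l, rfl⟩
    refine ⟨fun m hm => ?_, by simp⟩
    simp only [List.mem_append, List.mem_map, List.mem_singleton] at hm
    omega

/-- The condition on the color of a vertex in an LCO forest. -/
def ColorOK (c : List ℕ) (color : Option Color) (children : Forest) : Prop :=
  color.isSome ↔ children ≠ .nil ∧ 2 ≤ c.sum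

theorem dropLast_label (l : List ℕ) : (l.map (· + 1) ++ [1]).dropLast.map (· - 1) = l := by
  rw [List.dropLast_concat, List.map_map]
  exact (List.map_congr_left fun m _ => by simp).trans (List.map_id l)

theorem sum_label (l : List ℕ) : (l.map (· + 1) ++ [1]).sum = weight l + 1 := by
  rw [List.sum_append, List.sum_singleton]
  congr 1
  induction l with
  | nil => rfl
  | cons i l ih => rw [List.map_cons, List.sum_cons, ih, weight]; omega

theorem weight_reverse (l : List ℕ) : weight l.reverse = weight l := by
  induction l with
  | nil => rfl
  | cons i l ih => rw [List.reverse_cons, weight_append, ih, weight, weight, weight]; omega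

/-- The possible labels and colors of an internal vertex: `(1)` uncolored, or colored top, or
colored bottom. -/
theorem internal_cases {c : List ℕ} {color : Option Color} {children : Forest}
    (hc : Forest.IsLabel c) (h : ColorOK c color children) (hch : children ≠ .nil) :
    (c = [1] ∧ color = none) ∨
      ∃ j l, c = (j :: l).map (· + 1) ++ [1] ∧ (color = some .top ∨ color = some .bot) := by
  obtain ⟨l, rfl⟩ := isLabel_iff.mp hc
  rw [ColorOK, sum_label] at h
  cases l with
  | nil =>
    left
    simp only [weight] at h
    have : ¬ color.isSome := fun h' => by have := (h.mp h').2; omega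
    exact ⟨rfl, by simpa using this⟩
  | cons j l =>
    right
    refine ⟨j, l, rfl, ?_⟩
    simp only [weight] at h
    obtain ⟨x, rfl⟩ := Option.isSome_iff_exists.mp (h.mpr ⟨hch, by omega⟩)
    cases x <;> simp

theorem vertexCode_leaf (l : List ℕ) (color : Option Color) :
    vertexCode (l.map (· + 1) ++ [1]) color .nil = l.reverse := by
  rw [vertexCode, if_pos rfl, dropLast_label]

theorem vertexCode_bot {children : Forest} (h : children ≠ .nil) (j : ℕ) (l : List ℕ) :
    vertexCode ((j :: l).map (· + 1) ++ [1]) (some .bot) children = ((j + 1) :: l).reverse := by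
  rw [vertexCode, if_neg h, if_pos rfl, dropLast_label, List.modifyHead_cons]

theorem vertexCode_top {children : Forest} (h : children ≠ .nil) (l : List ℕ)
    {color : Option Color} (hc : color ≠ some .bot) :
    vertexCode (l.map (· + 1) ++ [1]) color children = (0 :: l).reverse := by
  rw [vertexCode, if_neg h, if_neg hc, dropLast_label]

theorem color_of_leaf {c : List ℕ} {color : Option Color} (h : ColorOK c color .nil) :
    color = none := by
  simpa [ColorOK] using h

theorem insertBody_vertex {c : List ℕ} {color : Option Color} {children : Forest}
    (hc : Forest.IsLabel c) (h : ColorOK c color children) (R : DyckWord)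
    (hR : children = .nil → R = 0) :
    insertBody (compSteps c) (color.getD .top) R.toList =
      (build (if children = .nil then peak else R) (vertexCode c color children)).toList := by
  by_cases hch : children = .nil
  · subst hch
    obtain ⟨l, rfl⟩ := isLabel_iff.mp hc
    rw [hR rfl, toList_zero, insertBody_nil, compSteps_label, vertexCode_leaf, if_pos rfl]
  · rw [if_neg hch]
    rcases internal_cases hc h hch with ⟨rfl, rfl⟩ | ⟨j, l, rfl, rfl | rfl⟩
    · have h1 := insertBody_top [] R
      have h2 := vertexCode_top hch [] (color := none) (by simp)
      rw [List.map_nil, List.nil_append] at h1 h2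
      rw [h2, Option.getD_none, h1]
    · rw [vertexCode_top hch _ (by simp), Option.getD_some, insertBody_top]
    · rw [vertexCode_bot hch, Option.getD_some, insertBody_bot]

theorem vertexCode_inj {c c' : List ℕ} {color color' : Option Color} {children : Forest}
    (hc : Forest.IsLabel c) (h : ColorOK c color children) (hc' : Forest.IsLabel c')
    (h' : ColorOK c' color' children)
    (e : vertexCode c color children = vertexCode c' color' children) :
    c = c' ∧ color = color' := by
  by_cases hch : children = .nil
  · subst hch
    obtain ⟨l, rfl⟩ := isLabel_iff.mp hc
    obtain ⟨l', rfl⟩ := isLabel_iff.mp hc'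
    rw [vertexCode_leaf, vertexCode_leaf, List.reverse_inj] at e
    rw [color_of_leaf h, color_of_leaf h', e]
    exact ⟨rfl, rfl⟩
  · have h1 := vertexCode_top hch [] (color := none) (by simp)
    rw [List.map_nil, List.nil_append] at h1
    rcases internal_cases hc h hch with ⟨rfl, rfl⟩ | ⟨j, l, rfl, rfl | rfl⟩ <;>
    rcases internal_cases hc' h' hch with ⟨rfl, rfl⟩ | ⟨j', l', rfl, rfl | rfl⟩ <;>
    simp [h1, vertexCode_bot hch, vertexCode_top hch _ (color := some .top) (by simp),
      -List.map_cons, -List.reverse_cons] at e ⊢ <;>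
    simp [e]

theorem exists_vertexCode_leaf (l : List ℕ) :
    ∃ c, Forest.IsLabel c ∧ ColorOK c none .nil ∧ vertexCode c none .nil = l :=
  ⟨_, isLabel_iff.mpr ⟨l.reverse, rfl⟩, by simp [ColorOK],
    (vertexCode_leaf _ _).trans l.reverse_reverse⟩

theorem exists_vertexCode_internal {l : List ℕ} (hl : l ≠ []) {children : Forest}
    (h : children ≠ .nil) : ∃ c color, Forest.IsLabel c ∧ ColorOK c color children ∧
      vertexCode c color children = l := by
  obtain ⟨l, rfl⟩ : ∃ l', l = l'.reverse := ⟨l.reverse, l.reverse_reverse.symm⟩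
  match l, hl with
  | [0], _ =>
    refine ⟨_, none, isLabel_iff.mpr ⟨[], rfl⟩, ?_, vertexCode_top h [] (by simp)⟩
    simp [ColorOK]
  | 0 :: j :: l, _ =>
    refine ⟨_, some .top, isLabel_iff.mpr ⟨j :: l, rfl⟩, ?_, vertexCode_top h _ (by simp)⟩
    rw [ColorOK, sum_label, weight]
    exact ⟨fun _ => ⟨h, by omega⟩, fun _ => rfl⟩
  | (j + 1) :: l, _ =>
    refine ⟨_, some .bot, isLabel_iff.mpr ⟨j :: l, rfl⟩, ?_, vertexCode_bot h j l⟩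
    rw [ColorOK, sum_label, weight]
    exact ⟨fun _ => ⟨h, by omega⟩, fun _ => rfl⟩

theorem weight_vertexCode_leaf {c : List ℕ} (hc : Forest.IsLabel c) (color : Option Color) :
    weight (vertexCode c color .nil) = c.sum - 1 := by
  obtain ⟨l, rfl⟩ := isLabel_iff.mp hc
  rw [vertexCode_leaf, weight_reverse, sum_label, Nat.add_sub_cancel]

theorem weight_vertexCode_internal {c : List ℕ} {color : Option Color} {children : Forest}
    (hc : Forest.IsLabel c) (h : ColorOK c color children) (hch : children ≠ .nil) :
    weight (vertexCode c color children) = c.sum := by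
  rcases internal_cases hc h hch with ⟨rfl, rfl⟩ | ⟨j, l, rfl, rfl | rfl⟩
  · have h1 := vertexCode_top hch [] (color := none) (by simp)
    rw [List.map_nil, List.nil_append] at h1
    rw [h1]
    rfl
  · rw [vertexCode_top hch _ (by simp), weight_reverse, sum_label, weight]
  · rw [vertexCode_bot hch, weight_reverse, sum_label, weight, weight]
    omega

namespace Forest

theorem IsLCO.steps_eq {T : Forest} (hT : T.IsLCO) : T.steps = T.word.toList := by
  induction T with
  | nil => rfl
  | cons c color children rest ih1 ih2 =>
    obtain ⟨hc, -, hcol, -, h1, h2⟩ := hT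
    rw [steps, ih1 h1, ih2 h2, word, toList_add,
      insertBody_vertex hc hcol _ fun h => by rw [h, word]]

theorem IsLCO.isLCOForestOf_iff {T : Forest} (hT : T.IsLCO) {P : DyckWord} :
    T.IsLCOForestOf P ↔ T.word = P := by
  rw [IsLCOForestOf, hT.steps_eq, and_iff_right hT, DyckWord.ext_iff]

theorem vertexCode_ne_nil {c : List ℕ} {color : Option Color} {children : Forest}
    (hc : IsLabel c) (h : ColorOK c color children) (hch : children ≠ .nil) :
    vertexCode c color children ≠ [] := by
  intro h1
  have h2 := weight_vertexCode_internal hc h hch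
  obtain ⟨l, rfl⟩ := isLabel_iff.mp hc
  rw [h1, sum_label, weight] at h2
  omega

/-- Each tree of an LCO forest gives a component of the path. -/
theorem tree_word {c : List ℕ} {color : Option Color} {children : Forest} (hc : IsLabel c)
    (h : ColorOK c color children) (B : DyckWord) :
    ∃ Q, build (if children = .nil then peak else B) (vertexCode c color children) =
      DyckWord.nest Q := by
  refine build_eq_nest ?_
  by_cases hch : children = .nil
  · exact .inl (if_pos hch)
  · exact .inr (vertexCode_ne_nil hc h hch)

theorem IsLCO.word_eq_zero {T : Forest} (hT : T.IsLCO) : T.word = 0 ↔ T = nil := by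
  cases T with
  | nil => simp [word]
  | cons c color children rest =>
    obtain ⟨Q, hQ⟩ := tree_word hT.1 hT.2.2.1 children.word
    simp only [reduceCtorEq, iff_false]
    rw [word, hQ]
    exact fun h => DyckWord.nest_ne_zero (add_eq_zero'.mp h).1

theorem numTrees_eq_zero {T : Forest} : T.numTrees = 0 ↔ T = nil := by
  cases T <;> simp [numTrees]

theorem IsLCO.numTrees_eq_one {T : Forest} (hT : T.IsLCO) :
    T.numTrees = 1 ↔ ∃ X, T.word = DyckWord.nest X := by
  cases T with
  | nil => simp [numTrees, word, eq_comm (a := (0 : DyckWord))]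
  | cons c color children rest =>
    obtain ⟨Q, hQ⟩ := tree_word hT.1 hT.2.2.1 children.word
    rw [numTrees, word, hQ, Nat.add_eq_right, numTrees_eq_zero,
      ← IsLCO.word_eq_zero hT.2.2.2.2.2]
    constructor
    · exact fun h => ⟨Q, by rw [h, add_zero]⟩
    · rintro ⟨X, hX⟩
      exact (nest_eq_add hX.symm).resolve_left DyckWord.nest_ne_zero

/-- The vertices with children of an LCO forest have a base as the path of their children. -/
theorem IsLCO.isBase_iff {T : Forest} (hT : T.IsLCO) :
    (T.LastLeafLarge ↔ ∀ Y, T.word ≠ Y + peak) ∧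
    ((T.numTrees ≠ 1 ∧ T.LastLeafLarge ∧ T ≠ nil) ↔ IsBase T.word ∧ T.word ≠ peak) := by
  suffices H : T.LastLeafLarge ↔ ∀ Y, T.word ≠ Y + peak by
    refine ⟨H, ?_⟩
    rw [H, ne_eq, hT.numTrees_eq_one, ne_eq, ← hT.word_eq_zero]
    constructor
    · rintro ⟨h1, h2, h3⟩
      exact ⟨⟨h3, fun Y h => absurd h (h2 Y), fun X h => absurd ⟨X, h⟩ h1⟩,
        fun h => h1 ⟨0, h⟩⟩
    · rintro ⟨h1, h2⟩
      refine ⟨?_, fun Y h => h2 ?_, h1.1⟩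
      · rintro ⟨X, h⟩
        exact h2 (by rw [h, h1.2.2 X h, peak])
      · rw [h, h1.2.1 Y h, zero_add]
  induction T with
  | nil =>
    exact iff_of_true trivial fun Y h => peak_ne_zero (add_eq_zero'.mp h.symm).2
  | cons c color children rest ih1 ih2 =>
    obtain ⟨hc, hn, hcol, hl, h1, h2⟩ := hT
    cases rest with
    | cons c' color' children' rest' =>
      rw [LastLeafLarge.eq_def]
      simp only
      rw [ih2 h2, show (cons c color children (cons c' color' children' rest')).word =
        _ + (cons c' color' children' rest').word from rfl]
      constructor
      · intro h Y hY
        have hne := h2.word_eq_zero.not.mpr (by simp)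
        obtain ⟨Y', Z, hYZ⟩ := exists_add_nest hne
        rw [hYZ, ← add_assoc] at hY
        exact h Y' (by rw [hYZ, add_nest_ne_add_peak hY, peak])
      · intro h Y hY
        exact h _ (by rw [hY, ← add_assoc])
    | nil =>
      rw [LastLeafLarge, word, word, add_zero]
      by_cases hch : children = nil
      · subst hch
        obtain ⟨l, rfl⟩ := isLabel_iff.mp hc
        rw [if_pos rfl, vertexCode_leaf, sum_label]
        constructor
        · intro h Y hY
          rw [build_eq_add_peak isBase_peak hY, zero_add] at hY
          have := (build_eq_peak isBase_peak hY).2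
          rw [List.reverse_eq_nil_iff.mp this, weight] at h
          exact absurd (h rfl) (by omega)
        · intro h _
          by_contra! h3
          have : l = [] := eq_nil_of_weight (by omega)
          exact h 0 (by rw [this]; simp [build])
      · rw [if_neg hch]
        refine iff_of_true (fun h => absurd h hch) fun Y hY => ?_
        have hne := h1.word_eq_zero.not.mpr hch
        obtain ⟨j, l', hjl⟩ := List.exists_cons_of_ne_nil (vertexCode_ne_nil hc hcol hch)
        rw [hjl] at hY
        have h0 := (nest_eq_add hY).resolve_right peak_ne_zero
        rw [h0, zero_add] at hY
        exact build_ne_zero hne _ (add_eq_zero'.mp (nest_injective hY)).1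

/-- The base of the first component of the path of an LCO forest. -/
theorem IsLCO.isBase_children {c : List ℕ} {color : Option Color} {children rest : Forest}
    (hT : (cons c color children rest).IsLCO) :
    IsBase (if children = nil then peak else children.word) ∧
      (children ≠ nil → children.word ≠ peak) := by
  by_cases hch : children = nil
  · rw [if_pos hch]
    exact ⟨isBase_peak, fun h => absurd hch h⟩
  · obtain ⟨-, hn, -, hl, h1, -⟩ := hT
    rw [if_neg hch]
    have := h1.isBase_iff.2.mp ⟨hn, hl, hch⟩
    exact ⟨this.1, fun _ => this.2⟩

theorem word_injOn {T T' : Forest} (hT : T.IsLCO) (hT' : T'.IsLCO) (h : T.word = T'.word) :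
    T = T' := by
  induction T generalizing T' with
  | nil => exact (hT'.word_eq_zero.mp h.symm).symm
  | cons c color children rest ih1 ih2 =>
    cases T' with
    | nil => exact hT.word_eq_zero.mp h
    | cons c' color' children' rest' =>
      obtain ⟨hB, hpk⟩ := hT.isBase_children
      obtain ⟨hB', hpk'⟩ := hT'.isBase_children
      obtain ⟨hc, -, hcol, -, h1, h2⟩ := hT
      obtain ⟨hc', -, hcol', -, h1', h2'⟩ := hT'
      obtain ⟨Q, hQ⟩ := tree_word hc hcol children.word
      obtain ⟨Q', hQ'⟩ := tree_word hc' hcol' children'.word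
      rw [word, word, hQ, hQ', nest_add_inj] at h
      rw [ih2 h2 h2' h.2]
      rw [h.1, ← hQ'] at hQ
      obtain ⟨e1, e2⟩ := build_inj hB hB' hQ
      obtain rfl : children = children' := by
        by_cases hch : children = nil <;> by_cases hch' : children' = nil
        · rw [hch, hch']
        · rw [if_pos hch, if_neg hch'] at e1
          exact absurd e1.symm (hpk' hch')
        · rw [if_neg hch, if_pos hch'] at e1
          exact absurd e1 (hpk hch)
        · rw [if_neg hch, if_neg hch'] at e1
          exact ih1 h1 h1' e1
      obtain ⟨rfl, rfl⟩ := vertexCode_inj hc hcol hc' hcol' e2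
      rfl

theorem exists_isLCO (P : DyckWord) : ∃ T : Forest, T.IsLCO ∧ T.word = P := by
  induction hn : P.semilength using Nat.strong_induction_on generalizing P with
  | _ n ih =>
    by_cases h : P = 0
    · exact ⟨nil, trivial, h.symm⟩
    · obtain ⟨Q, R, rfl⟩ := exists_nest_add h
      simp only [DyckWord.semilength_add, DyckWord.semilength_nest] at hn
      obtain ⟨rest, hr, hrR⟩ := ih _ (by omega) R rfl
      obtain ⟨B, l, hB, hl⟩ := exists_build_nest Q
      have h1 := congrArg DyckWord.semilength hl
      rw [DyckWord.semilength_nest, semilength_build] at h1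
      by_cases hpk : B = peak
      · obtain ⟨c, hc, hcol, hcode⟩ := exists_vertexCode_leaf l
        exact ⟨cons c none nil rest,
          ⟨hc, by simp [numTrees], hcol, trivial, trivial, hr⟩,
          by rw [word, if_pos rfl, hcode, hrR, hl, hpk]⟩
      · have hl0 := (hB.peak_or_ne_nil hl.symm).resolve_left hpk
        have hw : 0 < weight l := Nat.pos_of_ne_zero fun h => hl0 (eq_nil_of_weight h)
        obtain ⟨ch, hch, rfl⟩ := ih _ (by omega) B rfl
        obtain ⟨h2, h3, h4⟩ := hch.isBase_iff.2.mpr ⟨hB, hpk⟩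
        obtain ⟨c, color, hc, hcol, hcode⟩ := exists_vertexCode_internal hl0 h4
        exact ⟨cons c color ch rest, ⟨hc, h2, hcol, h3, hch, hr⟩,
          by rw [word, if_neg h4, hcode, hrR, hl]⟩

theorem existsUnique_isLCOForestOf (P : DyckWord) : ∃! T : Forest, T.IsLCOForestOf P := by
  obtain ⟨T, hT, hP⟩ := exists_isLCO P
  refine ⟨T, hT.isLCOForestOf_iff.mpr hP, fun T' hT' => ?_⟩
  exact word_injOn hT'.1 hT ((hT'.1.isLCOForestOf_iff.mp hT').trans hP.symm)

theorem max_sub_internal (l i s l' i' : ℕ) :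
    max (max (max (l - 2) (i - 1)) (s - 1)) (max (l' - 2) (i' - 1)) =
      max (max l l' - 2) (max (max s i) i' - 1) := by
  have h (a b c : ℕ) : max a b - c = max (a - c) (b - c) := by omega
  simp only [h]
  ac_rfl

theorem IsLCO.orbitSize_word {T : Forest} (hT : T.IsLCO) :
    orbitSize T.word = 2 ^ Nat.size (max (T.maxLeaf - 2) (T.maxInternal - 1)) := by
  induction T with
  | nil => simp [word, orbitSize_zero, maxLeaf, maxInternal]
  | cons c color children rest ih1 ih2 =>
    have hB := hT.isBase_children.1
    obtain ⟨hc, -, hcol, -, h1, h2⟩ := hT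
    rw [word, orbitSize_add, orbitSize_build hB, ih2 h2, maxLeaf, maxInternal]
    by_cases hch : children = nil
    · subst hch
      simp only [if_true]
      rw [orbitSize_peak, Nat.lcm_one_left, weight_vertexCode_leaf hc, lcm_two_pow_size]
      exact congrArg (fun a => 2 ^ Nat.size a) (by omega)
    · simp only [if_neg hch]
      rw [ih1 h1, weight_vertexCode_internal hc hcol hch, lcm_two_pow_size, lcm_two_pow_size]
      exact congrArg (fun a => 2 ^ Nat.size a) (max_sub_internal _ _ _ _ _)

end Forest

/-! ### Fixed points -/

theorem orbitSize_eq_one {P : DyckWord} : orbitSize P = 1 ↔ dyckF P = P :=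
  Function.minimalPeriod_eq_one_iff_isFixedPt

theorem orbitSize_add_eq_one {P Q : DyckWord} :
    orbitSize (P + Q) = 1 ↔ orbitSize P = 1 ∧ orbitSize Q = 1 := by
  rw [orbitSize_add, Nat.lcm_eq_one_iff]

theorem orbitSize_nest_eq_one {Q : DyckWord} :
    orbitSize Q.nest = 1 ↔ orbitSize Q = 1 ∧ (Q = 0 ∨ IsBase Q) := by
  constructor
  · intro h
    obtain ⟨B, l, hB, hl⟩ := exists_build_nest Q
    rw [hl, orbitSize_build hB, Nat.lcm_eq_one_iff, Nat.pow_eq_one, Nat.size_eq_zero] at h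
    obtain ⟨h1, h2⟩ := h
    have hw : weight l ≤ 1 := by omega
    match l with
    | [] =>
      have : Q = 0 := hB.2.2 Q hl.symm
      exact ⟨by rw [this, orbitSize_zero], .inl this⟩
    | i :: l =>
      rw [weight] at hw
      obtain rfl := eq_nil_of_weight (l := l) (by omega)
      obtain rfl : i = 0 := by omega
      have : Q = B := nest_injective (by simpa [build] using hl)
      exact ⟨this ▸ h1, .inr (this ▸ hB)⟩
  · rintro ⟨h, rfl | hQ⟩
    · exact orbitSize_peak
    · have := orbitSize_build hQ [0]
      rw [build, build, zero_nsmul, add_zero, h] at this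
      simpa [weight] using this

theorem count_le_of_prefix {P : DyckWord} {t : List DyckStep} (h : t <+: P.toList) :
    t.count D ≤ t.count U := by
  rw [List.prefix_iff_eq_take.mp h]
  exact P.count_D_le_count_U _

theorem count_le_of_suffix {P : DyckWord} {t : List DyckStep} (h : t <:+ P.toList) :
    t.count U ≤ t.count D := by
  obtain ⟨s, hs⟩ := h
  have h1 := P.count_U_eq_count_D
  have h2 := count_le_of_prefix (P := P) ⟨t, hs⟩
  rw [← hs, List.count_append, List.count_append] at h1
  omega

theorem count_lt_of_prefix_nest {Q : DyckWord} {s t : List DyckStep}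
    (h : s ++ t = Q.nest.toList) (hs : s ≠ []) (ht : t ≠ []) : s.count D < s.count U := by
  have := (DyckWord.IsNested.nest (p := Q)).2 (List.length_pos_iff.mpr hs)
    (by rw [← h, List.length_append]; have := List.length_pos_iff.mpr ht; omega)
  rwa [← h, List.take_left] at this

/-- The avoidance condition characterizing the fixed points. -/
def AvoidsPatterns (P : DyckWord) : Prop :=
  Avoids P [D, U, D, D] ∧ ∀ Q : DyckWord, Q ≠ 0 → Avoids P ([U, U] ++ Q.toList ++ [D, D])

theorem nest_nest_toList (R : DyckWord) :
    [U, U] ++ R.toList ++ [D, D] = R.nest.nest.toList := by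
  simp [toList_nest]

theorem infix_add_of_crossing {P Q : DyckWord} {w : List DyckStep}
    (h : ∀ s t, w = s ++ t → s ≠ [] → t ≠ [] → s <:+ P.toList → t <+: Q.toList → False) :
    w <:+: (P + Q).toList ↔ w <:+: P.toList ∨ w <:+: Q.toList := by
  rw [toList_add, List.infix_append_iff_ne_nil]
  constructor
  · rintro (h1 | h1 | ⟨s, t, h1, h2, h3, h4, h5⟩)
    · exact .inl h1
    · exact .inr h1
    · exact (h s t h3 h1 h2 h4 h5).elim
  · rintro (h1 | h1)
    · exact .inl h1
    · exact .inr (.inl h1)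

theorem infix_DUDD_add {P Q : DyckWord} : [D, U, D, D] <:+: (P + Q).toList ↔
    [D, U, D, D] <:+: P.toList ∨ [D, U, D, D] <:+: Q.toList := by
  refine infix_add_of_crossing fun s t e hs ht _ h => ?_
  have := count_le_of_prefix h
  match s, hs with
  | [a], _ => simp at e; simp [← e.2] at this
  | [a, b], _ => simp at e; simp [← e.2.2] at this
  | [a, b, c], _ => simp at e; simp [← e.2.2.2] at this
  | a :: b :: c :: d :: s, _ => simp at e; exact ht e.2.2.2.2.2

theorem infix_nest_add {P Q N : DyckWord} : N.nest.toList <:+: (P + Q).toList ↔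
    N.nest.toList <:+: P.toList ∨ N.nest.toList <:+: Q.toList := by
  refine infix_add_of_crossing fun s t e hs ht h _ => ?_
  have h1 := count_lt_of_prefix_nest e.symm hs ht
  have h2 := count_le_of_suffix h
  omega

theorem avoidsPatterns_add {P Q : DyckWord} :
    AvoidsPatterns (P + Q) ↔ AvoidsPatterns P ∧ AvoidsPatterns Q := by
  simp only [AvoidsPatterns, Avoids, nest_nest_toList, infix_DUDD_add, infix_nest_add, not_or]
  exact ⟨fun h => ⟨⟨h.1.1, fun R hR => (h.2 R hR).1⟩, h.1.2, fun R hR => (h.2 R hR).2⟩,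
    fun h => ⟨⟨h.1.1, h.2.1⟩, fun R hR => ⟨h.1.2 R hR, h.2.2 R hR⟩⟩⟩

theorem infix_nest_iff {w : List DyckStep} {Q : DyckWord} :
    w <:+: Q.nest.toList ↔ w <+: Q.nest.toList ∨ w <:+ Q.toList ++ [D] ∨ w <:+: Q.toList := by
  rw [toList_nest, List.cons_append, List.infix_cons_iff, List.infix_concat_iff]

theorem suffix_DUDD {Q : DyckWord} :
    [D, U, D, D] <:+ Q.toList ++ [D] ↔ ∃ Y, Q = Y + peak ∧ Y ≠ 0 := by
  have h0 : [D, U, D, D] <:+ Q.toList ++ [D] ↔ [D] ++ [U, D] <:+ Q.toList := by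
    rw [show [D, U, D, D] = [D, U, D] ++ [D] from rfl, List.suffix_append_inj_of_length_eq rfl]
    simp
  rw [h0]
  constructor
  · intro h
    obtain ⟨Y, rfl⟩ := suffix_peak_iff.mp ((List.suffix_append [D] [U, D]).trans h)
    refine ⟨Y, rfl, ?_⟩
    rintro rfl
    simpa [toList_peak] using h.length_le
  · rintro ⟨Y, rfl, hY⟩
    have h1 := DyckWord.toList_ne_nil.mpr hY
    rw [toList_add, toList_peak, List.suffix_append_inj_of_length_eq rfl,
      ← List.dropLast_append_getLast h1, Y.getLast_eq_D h1]
    exact ⟨List.suffix_append _ _, rfl⟩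

theorem infix_DUDD_nest {Q : DyckWord} : [D, U, D, D] <:+: Q.nest.toList ↔
    (∃ Y, Q = Y + peak ∧ Y ≠ 0) ∨ [D, U, D, D] <:+: Q.toList := by
  rw [infix_nest_iff, suffix_DUDD, or_iff_right]
  simp [toList_nest]

theorem infix_nest_nest {Q N : DyckWord} :
    N.nest.toList <:+: Q.nest.toList ↔ Q = N ∨ N.nest.toList <:+: Q.toList := by
  rw [infix_nest_iff]
  constructor
  · rintro (⟨t, ht⟩ | h | h)
    · left
      by_cases ht0 : t = []
      · subst ht0
        exact nest_injective (DyckWord.ext (by rw [← ht, List.append_nil]))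
      · have := count_lt_of_prefix_nest ht (DyckWord.toList_ne_nil.mpr DyckWord.nest_ne_zero) ht0
        rw [N.nest.count_U_eq_count_D] at this
        omega
    · rw [toList_nest, List.suffix_append_inj_of_length_eq rfl] at h
      have h1 := count_le_of_suffix h.1
      have h2 := N.count_U_eq_count_D
      simp only [List.count_cons] at h1
      simp at h1
      omega
    · exact .inr h
  · rintro (rfl | h)
    · exact .inl (List.prefix_rfl)
    · exact .inr (.inr h)

theorem avoidsPatterns_nest {Q : DyckWord} :
    AvoidsPatterns Q.nest ↔ AvoidsPatterns Q ∧ (Q = 0 ∨ IsBase Q) := by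
  have H : (Q = 0 ∨ IsBase Q) ↔
      (∀ Y, Q = Y + peak → Y = 0) ∧ ∀ X : DyckWord, Q = X.nest → X = 0 := by
    constructor
    · rintro (rfl | h)
      · exact ⟨fun Y h => (add_eq_zero'.mp h.symm).1, fun X h => absurd h.symm X.nest_ne_zero⟩
      · exact h.2
    · exact fun h => or_iff_not_imp_left.mpr fun h0 => ⟨h0, h⟩
  rw [H]
  simp only [AvoidsPatterns, Avoids, nest_nest_toList, infix_DUDD_nest, infix_nest_nest, not_or,
    not_exists, not_and, not_not]
  exact ⟨fun h => ⟨⟨h.1.2, fun R hR => (h.2 R hR).2⟩, h.1.1,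
      fun X hX => by_contra fun h' => (h.2 X h').1 hX⟩,
    fun h => ⟨⟨h.2.1, h.1.1⟩, fun R hR => ⟨fun e => hR (h.2.2 R e), h.1.2 R hR⟩⟩⟩

theorem dyckF_eq_self_iff {P : DyckWord} : dyckF P = P ↔ AvoidsPatterns P := by
  rw [← orbitSize_eq_one]
  induction P using nest_add_induction with
  | zero => exact iff_of_true orbitSize_zero (by simp [AvoidsPatterns, Avoids, toList_zero])
  | nest_add Q R ih1 ih2 =>
    rw [orbitSize_add_eq_one, orbitSize_nest_eq_one, avoidsPatterns_add, avoidsPatterns_nest, ih1,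
      ih2]

/-! ### Generating functions -/

/-- The generating function by size of a set of objects. -/
noncomputable def sizeGF {α : Type*} (size : α → ℕ) (s : Set α) : PowerSeries ℚ :=
  PowerSeries.mk fun n => (({a | a ∈ s ∧ size a = n}.ncard : ℕ) : ℚ)

section sizeGF

variable {α β : Type*} {size : α → ℕ} {size' : β → ℕ}

theorem sizeGF_union (hf : ∀ n, {a | size a = n}.Finite) {s t : Set α} (h : Disjoint s t) :
    sizeGF size (s ∪ t) = sizeGF size s + sizeGF size t := by
  ext n
  simp only [sizeGF, map_add, PowerSeries.coeff_mk]
  rw [← Nat.cast_add, ← Set.ncard_union_eq (h.mono (fun a ha => ha.1) fun a ha => ha.1)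
    ((hf n).subset fun a ha => ha.2) ((hf n).subset fun a ha => ha.2)]
  congr 2
  ext a
  simp only [Set.mem_ofPred_eq, Set.mem_union, or_and_right]

theorem sizeGF_image {s : Set α} {f : α → β} (hf : Set.InjOn f s) (d : ℕ)
    (h : ∀ a ∈ s, size' (f a) = size a + d) :
    sizeGF size' (f '' s) = PowerSeries.X ^ d * sizeGF size s := by
  ext n
  rw [PowerSeries.coeff_X_pow_mul']
  simp only [sizeGF, PowerSeries.coeff_mk]
  split_ifs with hn
  · rw [← Set.InjOn.ncard_image (hf.mono fun a (ha : a ∈ {a | a ∈ s ∧ size a = n - d}) => ha.1)]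
    congr 2
    ext b
    simp only [Set.mem_ofPred_eq, Set.mem_image]
    constructor
    · rintro ⟨⟨a, ha, rfl⟩, hb⟩
      rw [h a ha] at hb
      exact ⟨a, ⟨ha, by omega⟩, rfl⟩
    · rintro ⟨a, ⟨ha, hb⟩, rfl⟩
      exact ⟨⟨a, ha, rfl⟩, by rw [h a ha]; omega⟩
  · rw [Nat.cast_eq_zero, show {a | a ∈ f '' s ∧ size' a = n} = ∅ from ?_, Set.ncard_empty]
    rw [Set.eq_empty_iff_forall_notMem]
    rintro _ ⟨⟨a, ha, rfl⟩, hb⟩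
    rw [h a ha] at hb
    omega

theorem sizeGF_prod (hf : ∀ n, {a | size a = n}.Finite) (hf' : ∀ n, {b | size' b = n}.Finite)
    (s : Set α) (t : Set β) :
    sizeGF (fun p : α × β => size p.1 + size' p.2) (s ×ˢ t) = sizeGF size s * sizeGF size' t := by
  classical
  ext n
  have hs (i : ℕ) : {a | a ∈ s ∧ size a = i}.Finite := (hf i).subset fun a ha => ha.2
  have ht (i : ℕ) : {b | b ∈ t ∧ size' b = i}.Finite := (hf' i).subset fun a ha => ha.2
  have key : {p : α × β | p ∈ s ×ˢ t ∧ size p.1 + size' p.2 = n} =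
      ((Finset.HasAntidiagonal.antidiagonal n).biUnion fun i => (hs i.1).toFinset ×ˢ (ht i.2).toFinset :
        Finset (α × β)) := by
    ext p
    simp only [Set.mem_ofPred_eq, Set.mem_prod, Finset.coe_biUnion, Set.mem_iUnion,
      Finset.mem_coe,
      Finset.HasAntidiagonal.mem_antidiagonal, Finset.mem_product, Set.Finite.mem_toFinset]
    constructor
    · rintro ⟨⟨h1, h2⟩, h3⟩
      exact ⟨(size p.1, size' p.2), h3, ⟨h1, rfl⟩, h2, rfl⟩
    · rintro ⟨i, hi, ⟨h1, h2⟩, h3, h4⟩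
      exact ⟨⟨h1, h3⟩, by rw [h2, h4, hi]⟩
  rw [PowerSeries.coeff_mul]
  simp only [sizeGF, PowerSeries.coeff_mk]
  rw [key, Set.ncard_coe_finset, Finset.card_biUnion, Nat.cast_sum]
  · refine Finset.sum_congr rfl fun i _ => ?_
    rw [Finset.card_product, Nat.cast_mul, ← Set.ncard_eq_toFinset_card _ (hs i.1),
      ← Set.ncard_eq_toFinset_card _ (ht i.2)]
  · intro i _ j _ hij
    rw [Function.onFun, Finset.disjoint_left]
    intro p hp hp'
    simp only [Finset.mem_product, Set.Finite.mem_toFinset, Set.mem_ofPred_eq] at hp hp'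
    exact hij (Prod.ext (hp.1.2.symm.trans hp'.1.2) (hp.2.2.symm.trans hp'.2.2))

theorem sizeGF_singleton (a : α) : sizeGF size {a} = PowerSeries.X ^ size a := by
  ext n
  rw [sizeGF, PowerSeries.coeff_mk, PowerSeries.coeff_X_pow]
  split_ifs with h
  · rw [show {b | b ∈ ({a} : Set α) ∧ size b = n} = {a} by
      ext b; simp only [Set.mem_ofPred_eq, Set.mem_singleton_iff]; aesop]
    simp
  · rw [show {b | b ∈ ({a} : Set α) ∧ size b = n} = ∅ by
      ext b; simp only [Set.mem_ofPred_eq, Set.mem_singleton_iff]; aesop]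
    simp

end sizeGF

theorem finite_semilength (n : ℕ) : {P : DyckWord | P.semilength = n}.Finite :=
  Finite.of_injective (β := {P : DyckWord // P.semilength = n}) (fun P => ⟨P.1, P.2⟩)
    fun _ _ h => Subtype.ext (congrArg Subtype.val h)

theorem finite_ncard_weight (n : ℕ) :
    {l : List ℕ | weight l = n + 1}.Finite ∧ {l : List ℕ | weight l = n + 1}.ncard = 2 ^ n := by
  induction n with
  | zero =>
    have : {l : List ℕ | weight l = 0 + 1} = {[0]} := by
      ext l
      simp only [Set.mem_ofPred_eq, Set.mem_singleton_iff]
      constructor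
      · intro h
        match l with
        | [] => simp [weight] at h
        | i :: l =>
          rw [weight] at h
          rw [eq_nil_of_weight (l := l) (by omega), show i = 0 by omega]
      · rintro rfl
        rfl
    rw [this]
    simp
  | succ n ih =>
    have h1 : {l : List ℕ | weight l = n + 1 + 1} =
        (0 :: ·) '' {l : List ℕ | weight l = n + 1} ∪
        List.modifyHead (· + 1) '' {l : List ℕ | weight l = n + 1} := by
      ext l
      simp only [Set.mem_ofPred_eq, Set.mem_union, Set.mem_image]
      constructor
      · intro h
        match l with
        | [] => simp [weight] at h
        | 0 :: l => exact .inl ⟨l, by rw [weight] at h; omega, rfl⟩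
        | (i + 1) :: l => exact .inr ⟨i :: l, by rw [weight] at h ⊢; omega, rfl⟩
      · rintro (⟨l, h, rfl⟩ | ⟨l, h, rfl⟩)
        · rw [weight]; omega
        · cases l with
          | nil => simp [weight] at h
          | cons i l => rw [weight] at h; rw [List.modifyHead_cons, weight]; omega
    have hi : Function.Injective (List.modifyHead (· + 1) : List ℕ → List ℕ) := by
      intro l l' h
      cases l <;> cases l' <;> simp_all
    rw [h1]
    refine ⟨(ih.1.image _).union (ih.1.image _), ?_⟩
    rw [Set.ncard_union_eq _ (ih.1.image _) (ih.1.image _),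
      Set.ncard_image_of_injective _ List.cons_injective, Set.ncard_image_of_injective _ hi, ih.2,
      pow_succ, mul_two]
    rw [Set.disjoint_left]
    rintro _ ⟨l, -, rfl⟩ ⟨l', -, h⟩
    cases l' <;> simp at h

theorem finite_weight (n : ℕ) : {l : List ℕ | weight l = n}.Finite := by
  cases n with
  | zero => exact (Set.finite_singleton []).subset fun l hl => eq_nil_of_weight hl
  | succ n => exact (finite_ncard_weight n).1

open PowerSeries in
theorem sizeGF_weight_le (N : ℕ) : sizeGF weight {l | weight l ≤ N} =
    1 + X * ∑ i ∈ Finset.range N, (2 * X) ^ i := by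
  ext n
  rw [map_add, coeff_one, sizeGF, coeff_mk]
  simp only [Set.mem_ofPred_eq]
  cases n with
  | zero =>
    rw [coeff_zero_X_mul, show {l | weight l ≤ N ∧ weight l = 0} = {[]} from ?_]
    · simp
    · ext l
      simp only [Set.mem_ofPred_eq, Set.mem_singleton_iff]
      exact ⟨fun h => eq_nil_of_weight h.2, by rintro rfl; simp [weight]⟩
  | succ n =>
    have (i : ℕ) : coeff n ((2 * X : PowerSeries ℚ) ^ i) = if n = i then 2 ^ n else 0 := by
      rw [mul_pow, show (2 : PowerSeries ℚ) = C 2 from rfl, ← map_pow, coeff_C_mul, coeff_X_pow]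
      split_ifs with h
      · rw [h, mul_one]
      · rw [mul_zero]
    rw [coeff_succ_X_mul, map_sum, if_neg (by omega), zero_add]
    simp only [this]
    rw [Finset.sum_ite_eq]
    simp only [Finset.mem_range]
    split_ifs with h
    · rw [show {l | weight l ≤ N ∧ weight l = n + 1} = {l | weight l = n + 1} from ?_,
        (finite_ncard_weight n).2]
      · simp
      · ext l
        simp only [Set.mem_ofPred_eq]
        omega
    · rw [show {l | weight l ≤ N ∧ weight l = n + 1} = ∅ from ?_]
      · simp
      · ext l
        simp only [Set.mem_ofPred_eq, Set.mem_empty_iff_false, iff_false]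
        omega

open PowerSeries in
theorem mul_sizeGF_weight (k : ℕ) :
    2 * (1 - 2 * X) * sizeGF weight {l | weight l ≤ 2 ^ k} = 2 - 2 * X - aSeries k := by
  rw [sizeGF_weight_le, aSeries, pow_succ]
  have := mul_neg_geom_sum (2 * X : PowerSeries ℚ) (2 ^ k)
  linear_combination 2 * X * this

theorem lcm_orbitSize_le {P : DyckWord} (b k : ℕ) :
    Nat.lcm (orbitSize P) (2 ^ Nat.size b) ≤ 2 ^ k ↔ orbitSize P ≤ 2 ^ k ∧ Nat.size b ≤ k := by
  obtain ⟨a, ha⟩ := exists_orbitSize P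
  rw [ha, lcm_two_pow_size, Nat.pow_le_pow_iff_right (by omega),
    Nat.pow_le_pow_iff_right (by omega)]
  simp only [Nat.size_le, max_lt_iff]

theorem orbitSize_add_le {P Q : DyckWord} {k : ℕ} :
    orbitSize (P + Q) ≤ 2 ^ k ↔ orbitSize P ≤ 2 ^ k ∧ orbitSize Q ≤ 2 ^ k := by
  obtain ⟨b, hb⟩ := exists_orbitSize Q
  rw [orbitSize_add, hb, lcm_orbitSize_le, Nat.pow_le_pow_iff_right (by omega)]

theorem orbitSize_build_le {B : DyckWord} (hB : IsBase B) {l : List ℕ} {k : ℕ} :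
    orbitSize (build B l) ≤ 2 ^ k ↔ orbitSize B ≤ 2 ^ k ∧ weight l ≤ 2 ^ k := by
  rw [orbitSize_build hB, lcm_orbitSize_le, Nat.size_le]
  have : 0 < 2 ^ k := by positivity
  exact and_congr_right fun _ => by omega

/-- The paths with orbit of size at most `2 ^ k`. -/
def smallOrbit (k : ℕ) : Set DyckWord := {P | orbitSize P ≤ 2 ^ k}

theorem zero_mem_smallOrbit (k : ℕ) : 0 ∈ smallOrbit k := by
  rw [smallOrbit, Set.mem_ofPred_eq, orbitSize_zero]
  exact Nat.one_le_two_pow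

theorem peak_mem_smallOrbit (k : ℕ) : peak ∈ smallOrbit k := by
  rw [smallOrbit, Set.mem_ofPred_eq, orbitSize_peak]
  exact Nat.one_le_two_pow

/-- The primitive paths with orbit of size at most `2 ^ k`. -/
def smallPrimitive (k : ℕ) : Set DyckWord := {P ∈ smallOrbit k | ∃ Q : DyckWord, P = Q.nest}

/-- The bases with orbit of size at most `2 ^ k`. -/
def smallBase (k : ℕ) : Set DyckWord := {P ∈ smallOrbit k | IsBase P}

/-- The paths with orbit of size at most `2 ^ k` obtained from bases by `build`. -/
def smallBuild (k : ℕ) : Set DyckWord :=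
  (fun p : DyckWord × List ℕ => build p.1 p.2) '' (smallBase k ×ˢ {l | weight l ≤ 2 ^ k})

theorem mem_smallBuild {k : ℕ} {P : DyckWord} :
    P ∈ smallBuild k ↔ P ∈ smallOrbit k ∧ ∃ B l, IsBase B ∧ P = build B l := by
  constructor
  · rintro ⟨⟨B, l⟩, ⟨⟨h1, h2⟩, h3⟩, rfl⟩
    exact ⟨(orbitSize_build_le h2).mpr ⟨h1, h3⟩, B, l, h2, rfl⟩
  · rintro ⟨h, B, l, hB, rfl⟩
    obtain ⟨h1, h2⟩ := (orbitSize_build_le hB).mp h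
    exact ⟨(B, l), ⟨⟨h1, hB⟩, h2⟩, rfl⟩

theorem smallOrbit_eq_components (k : ℕ) : smallOrbit k =
    {0} ∪ (fun p : DyckWord × DyckWord => p.1 + p.2) '' (smallPrimitive k ×ˢ smallOrbit k) := by
  ext P
  constructor
  · intro hP
    by_cases h : P = 0
    · exact .inl h
    · obtain ⟨Q, R, rfl⟩ := exists_nest_add h
      obtain ⟨h1, h2⟩ := orbitSize_add_le.mp hP
      exact .inr ⟨(Q.nest, R), ⟨⟨h1, Q, rfl⟩, h2⟩, rfl⟩
  · rintro (rfl | ⟨p, ⟨⟨h1, -⟩, h2⟩, rfl⟩)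
    · exact zero_mem_smallOrbit k
    · exact orbitSize_add_le.mpr ⟨h1, h2⟩

theorem smallOrbit_eq_build (k : ℕ) : smallOrbit k =
    {0} ∪ ((· + peak) '' (smallOrbit k \ {0}) ∪ smallBuild k) := by
  ext P
  constructor
  · intro hP
    by_cases h : P = 0
    · exact .inl h
    · right
      by_cases h' : ∀ Y, P = Y + peak → Y = 0
      · exact .inr (mem_smallBuild.mpr ⟨hP, exists_build h h'⟩)
      · push Not at h'
        obtain ⟨Y, rfl, hY⟩ := h'
        exact .inl ⟨Y, ⟨(orbitSize_add_le.mp hP).1, hY⟩, rfl⟩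
  · rintro (rfl | ⟨Y, ⟨hY, -⟩, rfl⟩ | h)
    · exact zero_mem_smallOrbit k
    · exact orbitSize_add_le.mpr ⟨hY, peak_mem_smallOrbit k⟩
    · exact (mem_smallBuild.mp h).1

theorem smallBuild_eq (k : ℕ) : smallBuild k = smallPrimitive k ∪ smallBase k \ {peak} := by
  ext P
  rw [mem_smallBuild]
  constructor
  · rintro ⟨h, B, l, hB, rfl⟩
    by_cases hl : B = peak ∨ l ≠ []
    · exact .inl ⟨h, build_eq_nest hl⟩
    · push Not at hl
      obtain ⟨h1, rfl⟩ := hl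
      exact .inr ⟨⟨h, hB⟩, h1⟩
  · rintro (⟨h, Q, rfl⟩ | ⟨⟨h, hB⟩, -⟩)
    · exact ⟨h, exists_build_nest Q⟩
    · exact ⟨h, P, [], hB, rfl⟩

theorem sizeGF_diff_singleton {s : Set DyckWord} {P : DyckWord} (h : P ∈ s) :
    sizeGF DyckWord.semilength s =
      PowerSeries.X ^ P.semilength + sizeGF DyckWord.semilength (s \ {P}) := by
  rw [← sizeGF_singleton, ← sizeGF_union finite_semilength Set.disjoint_sdiff_right,
    Set.union_sdiff_cancel (Set.singleton_subset_iff.mpr h)]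

theorem orbitGF_eq_sizeGF (k : ℕ) : orbitGF k = sizeGF DyckWord.semilength (smallOrbit k) := by
  ext n
  simp only [orbitGF, sizeGF, smallOrbit, PowerSeries.coeff_mk, Set.mem_ofPred_eq, and_comm]

theorem orbitGF_eq_components (k : ℕ) : orbitGF k =
    1 + sizeGF DyckWord.semilength (smallPrimitive k) * orbitGF k := by
  rw [orbitGF_eq_sizeGF]
  conv_lhs => rw [smallOrbit_eq_components]
  rw [sizeGF_union finite_semilength, sizeGF_singleton, DyckWord.semilength_zero, pow_zero,
    sizeGF_image (size := fun p : DyckWord × DyckWord => p.1.semilength + p.2.semilength) _ 0,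
    pow_zero, one_mul, sizeGF_prod finite_semilength finite_semilength]
  · intro p _
    simp
  · rintro ⟨_, R⟩ ⟨⟨-, Q, rfl⟩, -⟩ ⟨_, R'⟩ ⟨⟨-, Q', rfl⟩, -⟩ h
    obtain ⟨rfl, rfl⟩ := nest_add_inj.mp h
    rfl
  · rw [Set.disjoint_singleton_left]
    rintro ⟨⟨_, R⟩, ⟨⟨-, Q, rfl⟩, -⟩, h⟩
    exact DyckWord.nest_ne_zero (add_eq_zero'.mp h).1

theorem sizeGF_smallBuild (k : ℕ) : sizeGF DyckWord.semilength (smallBuild k) =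
    sizeGF DyckWord.semilength (smallBase k) * sizeGF weight {l | weight l ≤ 2 ^ k} := by
  rw [smallBuild, sizeGF_image (size := fun p : DyckWord × List ℕ => p.1.semilength + weight p.2)
    _ 0, pow_zero, one_mul, sizeGF_prod finite_semilength finite_weight]
  · rintro ⟨B, l⟩ _
    exact semilength_build B l
  · rintro ⟨B, l⟩ ⟨⟨-, hB⟩, -⟩ ⟨B', l'⟩ ⟨⟨-, hB'⟩, -⟩ h
    exact Prod.ext_iff.mpr (build_inj hB hB' h)

theorem orbitGF_eq_build (k : ℕ) : orbitGF k =
    1 + (PowerSeries.X * (orbitGF k - 1) + sizeGF DyckWord.semilength (smallBuild k)) := by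
  have h0 := sizeGF_diff_singleton (zero_mem_smallOrbit k)
  rw [DyckWord.semilength_zero, pow_zero, ← orbitGF_eq_sizeGF] at h0
  conv_lhs => rw [orbitGF_eq_sizeGF, smallOrbit_eq_build]
  rw [sizeGF_union finite_semilength, sizeGF_union finite_semilength, sizeGF_singleton,
    DyckWord.semilength_zero, pow_zero,
    sizeGF_image (size := DyckWord.semilength) (add_left_injective peak).injOn 1, pow_one, h0,
    add_sub_cancel_left]
  · exact fun P _ => by rw [DyckWord.semilength_add, semilength_peak]
  · rw [Set.disjoint_left]
    rintro _ ⟨Y, ⟨-, hY⟩, rfl⟩ h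
    obtain ⟨-, B, l, hB, h⟩ := mem_smallBuild.mp h
    exact hY (build_eq_add_peak hB h.symm)
  · rw [Set.disjoint_singleton_left]
    rintro (⟨Y, -, h⟩ | h)
    · exact peak_ne_zero (add_eq_zero'.mp h).2
    · obtain ⟨-, B, l, hB, h⟩ := mem_smallBuild.mp h
      exact build_ne_zero hB.1 l h.symm

theorem sizeGF_smallBuild_eq_add (k : ℕ) :
    sizeGF DyckWord.semilength (smallBuild k) + PowerSeries.X =
      sizeGF DyckWord.semilength (smallPrimitive k) +
        sizeGF DyckWord.semilength (smallBase k) := by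
  have h0 := sizeGF_diff_singleton (s := smallBase k) ⟨peak_mem_smallOrbit k, isBase_peak⟩
  rw [semilength_peak, pow_one] at h0
  rw [smallBuild_eq, sizeGF_union finite_semilength, h0]
  · ring
  · rw [Set.disjoint_left]
    rintro _ ⟨-, Q, rfl⟩ ⟨⟨-, hB⟩, h⟩
    exact h (by rw [hB.2.2 Q rfl]; rfl)

open PowerSeries in
theorem orbitGF_quadratic (k : ℕ) :
    (2 * X - aSeries k) * (1 - X) * orbitGF k ^ 2 - 2 * (1 - aSeries k) * (1 - X) * orbitGF k +
      (2 - 2 * X - aSeries k) = 0 := by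
  have h1 := orbitGF_eq_components k
  have h2 := orbitGF_eq_build k
  have h3 := sizeGF_smallBuild_eq_add k
  have h4 := sizeGF_smallBuild k
  have h5 := mul_sizeGF_weight k
  set F := orbitGF k
  set a := aSeries k
  set c := sizeGF weight {l | weight l ≤ 2 ^ k}
  set p := sizeGF DyckWord.semilength (smallPrimitive k)
  set b := sizeGF DyckWord.semilength (smallBase k)
  set m := sizeGF DyckWord.semilength (smallBuild k)
  have h6 : c * (F - 1) = F * ((c - 1) * ((1 - X) * (F - 1)) + X * c) := by
    linear_combination c * h1 - c * F * h3 + F * h4 - (c - 1) * F * h2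
  linear_combination (-2 * (1 - 2 * X)) * h6 + (F - 1 - F * (1 - X) * (F - 1) - X * F) * h5

open PowerSeries in
theorem exists_sqrt_orbitGF (k : ℕ) : ∃ S : PowerSeries ℚ, constantCoeff S = 1 ∧
    S ^ 2 = 1 - 4 * X + aSeries k * (2 - aSeries k) * X * (1 - X)⁻¹ ∧
    (2 * X - aSeries k) * orbitGF k = 1 - aSeries k - S := by
  refine ⟨1 - aSeries k - (2 * X - aSeries k) * orbitGF k, ?_, ?_, by ring⟩
  · simp [aSeries]
  · have h := orbitGF_quadratic k
    have hv : (1 - X : PowerSeries ℚ) * (1 - X)⁻¹ = 1 := PowerSeries.mul_inv_cancel _ (by simp)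
    set v := (1 - X : PowerSeries ℚ)⁻¹
    linear_combination (2 * X - aSeries k) * v * h -
      ((1 - aSeries k - (2 * X - aSeries k) * orbitGF k) ^ 2 - 1 + 4 * X) * hv

end DyckOrbit

theorem mainTheorem3 :
    (∀ P : DyckWord, ∃ k : ℕ, DyckOrbit.orbitSize P = 2 ^ k) ∧
    (∀ P : DyckWord, ∃! T : DyckOrbit.Forest, T.IsLCOForestOf P) ∧
    (∀ (P : DyckWord) (T : DyckOrbit.Forest), T.IsLCOForestOf P →
      DyckOrbit.orbitSize P = 2 ^ Nat.size (max (T.maxLeaf - 2) (T.maxInternal - 1))) ∧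
    (∀ P : DyckWord, DyckOrbit.dyckF P = P ↔
      DyckOrbit.Avoids P [D, U, D, D] ∧
      ∀ Q : DyckWord, Q ≠ 0 → DyckOrbit.Avoids P ([U, U] ++ Q.toList ++ [D, D])) ∧
    (∀ k : ℕ, ∃ S : PowerSeries ℚ,
      PowerSeries.constantCoeff S = 1 ∧
      S ^ 2 = 1 - 4 * PowerSeries.X +
        DyckOrbit.aSeries k * (2 - DyckOrbit.aSeries k) * PowerSeries.X *
          (1 - PowerSeries.X)⁻¹ ∧
      (2 * PowerSeries.X - DyckOrbit.aSeries k) * DyckOrbit.orbitGF k =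
        1 - DyckOrbit.aSeries k - S) :=
  ⟨fun P => (DyckOrbit.exists_orbitSize P).imp' _ fun _ h => h,
    DyckOrbit.Forest.existsUnique_isLCOForestOf,
    fun _ _ hT => hT.1.isLCOForestOf_iff.mp hT ▸ hT.1.orbitSize_word,
    fun _ => DyckOrbit.dyckF_eq_self_iff,
    DyckOrbit.exists_sqrt_orbitGF⟩
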